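/- For words over an alphabet, the shuffle is defined recursively by $w \,\sqcup\!\sqcup\, \epsilon = \epsilon \,\sqcup\!\sqcup\, w = \{w\}$ and $a w_1 \,\sqcup\!\sqcup\, b w_2 = a(w_1 \,\sqcup\!\sqcup\, b w_2) \cup b(a w_1 \,\sqcup\!\sqcup\, w_2)$ for letters $a,b$. For languages, $\mathcal L_1 \,\sqcup\!\sqcup\, \mathcal L_2 = \bigcup_{w_1\in\mathcal L_1,\,w_2\in\mathcal L_2} (w_1 \,\sqcup\!\sqcup\, w_2)$, where $\mathcal L_1$ and $\mathcal L_2$ are taken over disjoint alphabets; if they share letters, the letters are first renamed injectively (for example by adding a bar to the letters of $\mathcal L_2$) so that the alphabets become disjoint. For a class $\mathcal C$ of languages, let $S_0=\mathcal C$ and $S_n=\{\mathcal L_1 \,\sqcup\!\sqcup\, \mathcal L_2 : \mathcal L_1\in S_{n-1},\ \mathcal L_2\in\mathcal C\}$ for $n\ge 1$. The shuffle closure of $\mathcal C$ is $\bigcup_{n\ge 0} S_n$. Let $\mathcal C$ be the class of context-free languages that are not inherently ambiguous, that is, of the languages generated by a context-free grammar in which every generated word has exactly one leftmost derivation. Then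 every language $\mathcal L$ in the shuffle closure of $\mathcal C$ has only finitely many words of each length, and its ordinary generating function $L(z)=\sum_{w\in\mathcal L} z^{|w|}=\sum_{n\ge 0}\ell(n)z^n$, where $\ell(n)$ is the number of words of length $n$ in $\mathcal L$, is D-finite: there are $r\ge 0$ and polynomials $p_0,\dots,p_r\in\mathbb Q[z]$ with $p_r\neq 0$ such that $\sum_{i=0}^r p_i(z)\,L^{(i)}(z)=0$. -/

import Mathlib

universe u

/-- One leftmost rewriting step with the rule `r`: the leftmost nonterminal of the sentential form
is the left-hand side of `r`, and it is replaced by the right-hand side of `r`. -/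
def ContextFreeRule.LeftmostRewrites {T : Type*} {N : Type*} (r : ContextFreeRule T N)
    (x y : List (Symbol T N)) : Prop :=
  ∃ (p : List T) (q : List (Symbol T N)),
    x = p.map Symbol.terminal ++ [Symbol.nonterminal r.input] ++ q ∧
    y = p.map Symbol.terminal ++ r.output ++ q

namespace ContextFreeGrammar

/-- `g.LeftmostDerivation rs x y`: applying the rules in the list `rs`, all of them rules of `g`,
one after the other, always to the leftmost nonterminal, leads from `x` to `y`. A leftmost
derivation starting at `x` is determined by the list of rules that it applies. -/
inductive LeftmostDerivation {T : Type*} (g : ContextFreeGrammar T) :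
    List (ContextFreeRule T g.NT) → List (Symbol T g.NT) → List (Symbol T g.NT) → Prop
  | nil (x : List (Symbol T g.NT)) : LeftmostDerivation g [] x x
  | cons {r : ContextFreeRule T g.NT} {rs : List (ContextFreeRule T g.NT)}
      {x y z : List (Symbol T g.NT)} (hr : r ∈ g.rules) (hxy : r.LeftmostRewrites x y)
      (hyz : LeftmostDerivation g rs y z) : LeftmostDerivation g (r :: rs) x z

/-- A context-free grammar is unambiguous if every word of its language has exactly one leftmost
derivation (equivalently, exactly one derivation tree) from the initial nonterminal. -/
def IsUnambiguous {T : Type*} (g : ContextFreeGrammar T) : Prop :=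
  ∀ w ∈ g.language, ∃! rs : List (ContextFreeRule T g.NT),
    g.LeftmostDerivation rs [Symbol.nonterminal g.initial] (w.map Symbol.terminal)

end ContextFreeGrammar

/-- A class of languages: for every alphabet, a set of languages over that alphabet. -/
abbrev LanguageClass : Type (u + 1) := ∀ T : Type u, Set (Language T)

/-- The class of context-free languages that are not inherently ambiguous, that is, the languages
generated by some unambiguous context-free grammar. -/
def unambiguousContextFree : LanguageClass.{u} := fun T =>
  {L : Language T | ∃ g : ContextFreeGrammar T, g.language = L ∧ g.IsUnambiguous}

/-- The set of all shuffles (interleavings) of two words, by recursion on the first letters. -/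
def wordShuffle {T : Type*} : List T → List T → Set (List T)
  | [], w => {w}
  | w, [] => {w}
  | a :: w₁, b :: w₂ =>
      (List.cons a) '' wordShuffle w₁ (b :: w₂) ∪ (List.cons b) '' wordShuffle (a :: w₁) w₂

namespace Language

/-- The shuffle of two languages: the union of the shuffles of their words. -/
def shuffle {T : Type*} (L₁ L₂ : Language T) : Language T :=
  {w : List T | ∃ w₁ ∈ L₁, ∃ w₂ ∈ L₂, w ∈ wordShuffle w₁ w₂}

/-- The letters that occur in the words of a language. -/
def letters {T : Type*} (L : Language T) : Set T :=
  {a : T | ∃ w ∈ L, a ∈ w}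

/-- `L` is the shuffle of `L₁` and `L₂` on disjoint alphabets: the letters of `L₁` and of `L₂` are
renamed injectively (by `f` and `g`) so that the two alphabets become disjoint, and then the
languages are shuffled. If the alphabets are disjoint subsets of one type, `f` and `g` can be
the identity; if they share letters, `g` may add a bar to the letters of `L₂`, as with
`f = Sum.inl` and `g = Sum.inr`. -/
def IsDisjointShuffle {A B T : Type*} (L₁ : Language A) (L₂ : Language B) (L : Language T) :
    Prop :=
  ∃ (f : A → T) (g : B → T), Set.InjOn f L₁.letters ∧ Set.InjOn g L₂.letters ∧
    Disjoint (f '' L₁.letters) (g '' L₂.letters) ∧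
    L = (Language.map f L₁).shuffle (Language.map g L₂)

/-- A language is proper if it has only finitely many words of each length. -/
def IsProper {T : Type*} (L : Language T) : Prop :=
  ∀ n : ℕ, {w : List T | w ∈ L ∧ w.length = n}.Finite

/-- The ordinary generating function `∑ ℓ(n) zⁿ` of a (proper) language, where `ℓ(n)` is its number
of words of length `n`. -/
noncomputable def genFun {T : Type*} (L : Language T) : PowerSeries ℚ :=
  PowerSeries.mk fun n => (({w : List T | w ∈ L ∧ w.length = n}.ncard : ℕ) : ℚ)

end Language

namespace LanguageClass

/-- The levels of the shuffle closure of a class `C`: `S₀ = C`, and `Sₙ₊₁` consists of the shuffles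
of a language of `Sₙ` with a language of `C`, on disjoint alphabets. -/
def shuffleLevel (C : LanguageClass.{u}) : ℕ → LanguageClass.{u}
  | 0 => C
  | n + 1 => fun T => {L : Language T | ∃ (A B : Type u) (L₁ : Language A) (L₂ : Language B),
      L₁ ∈ shuffleLevel C n A ∧ L₂ ∈ C B ∧ Language.IsDisjointShuffle L₁ L₂ L}

/-- The shuffle closure of a class of languages: the union of its levels. -/
def shuffleClosure (C : LanguageClass.{u}) : LanguageClass.{u} :=
  fun T => ⋃ n : ℕ, shuffleLevel C n T

end LanguageClass

/-- A formal power series is D-finite if it satisfies a nontrivial linear differential equation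
`p₀ f + p₁ f' + ⋯ + pᵣ f⁽ʳ⁾ = 0` with polynomial coefficients, `pᵣ ≠ 0`. -/
def PowerSeries.IsDFinite {K : Type*} [Field K] (f : PowerSeries K) : Prop :=
  ∃ (r : ℕ) (p : ℕ → Polynomial K), p r ≠ 0 ∧
    ∑ i ∈ Finset.range (r + 1),
      (p i : PowerSeries K) * (⇑(PowerSeries.derivative K))^[i] f = 0

/-! Two words of lengths k and m over disjoint alphabets have (k+m choose k) shuffles, and each
shuffle determines both words. Hence the exponential generating function of a shuffle is the product
of those of its factors (`borel_genFun_shuffle`). D-finiteness passes between ordinary and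
exponential generating functions, because it amounts to a polynomial recurrence for the coefficients
(`IsDFinite.borel`, `IsDFinite.of_borel`), and it is stable under products (`IsDFinite.mul`).
Induction on the level reduces the theorem to one unambiguous grammar.

There the generating function is algebraic (Chomsky–Schützenberger), hence D-finite
(`isDFinite_of_isAlgebraic`). Uniqueness of derivations turns concatenation into product and choice
of a rule into sum, so the series of the nonterminals solve a polynomial system
(`aeval_ntEquation`). Algebraicity follows from a nonzero Jacobian
(`isAlgebraic_of_det_pderiv_ne_zero`): its constant term is the identity minus a matrix supported on
pairs (A, B) such that A derives B up to erasable factors. A cycle of such pairs would give some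
word a second derivation, so this matrix is nilpotent (`det_pderiv_ntEquation_ne_zero`). No normal
form of the grammar is needed. -/

open Polynomial

/-! ### D-finiteness in terms of the Euler operator θ = z d/dz. -/

namespace PowerSeries

variable {K : Type*} [Field K]

/-- The power series `Q(θ) f`, where `θ = z d/dz` multiplies the `n`-th coefficient by `n`. -/
noncomputable def eulerEval (Q : K[X]) (f : PowerSeries K) : PowerSeries K :=
  PowerSeries.mk fun n => Q.eval (n : K) * PowerSeries.coeff n f

lemma coeff_eulerEval (Q : K[X]) (f : PowerSeries K) (n : ℕ) :
    PowerSeries.coeff n (eulerEval Q f) = Q.eval (n : K) * PowerSeries.coeff n f := by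
  simp [eulerEval]

lemma eulerEval_sum {ι : Type*} (s : Finset ι) (Q : ι → K[X]) (f : PowerSeries K) :
    eulerEval (∑ i ∈ s, Q i) f = ∑ i ∈ s, eulerEval (Q i) f := by
  ext n
  simp [coeff_eulerEval, Polynomial.eval_finsetSum, Finset.sum_mul]

lemma eulerEval_C_mul (c : K) (Q : K[X]) (f : PowerSeries K) :
    eulerEval (Polynomial.C c * Q) f = PowerSeries.C c * eulerEval Q f := by
  ext n
  simp [coeff_eulerEval, mul_assoc]

/-- The operator identity θ(θ-1)⋯(θ-i+1) = zⁱ dⁱ/dzⁱ, the dictionary between the two kinds of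
operator. -/
lemma eulerEval_descPochhammer (i : ℕ) (f : PowerSeries K) :
    eulerEval (descPochhammer K i) f
      = (PowerSeries.X : PowerSeries K) ^ i * (⇑(PowerSeries.derivative K))^[i] f := by
  ext n
  rw [coeff_eulerEval, PowerSeries.coeff_X_pow_mul', descPochhammer_eval_eq_descFactorial]
  split_ifs with h
  · obtain ⟨k, rfl⟩ := Nat.exists_eq_add_of_le' h
    rw [Nat.add_sub_cancel, PowerSeries.coeff_iterate_derivative, Nat.add_descFactorial_eq_ascFactorial]
  · rw [Nat.descFactorial_of_lt (by omega)]
    simp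

/-- `f` is annihilated by a nonzero operator `∑ zᵐ Qₘ(θ)`. -/
def IsEulerFinite (f : PowerSeries K) : Prop :=
  ∃ (M : ℕ) (Q : ℕ → K[X]), (∃ m ∈ Finset.range (M + 1), Q m ≠ 0) ∧
    ∑ m ∈ Finset.range (M + 1), (PowerSeries.X : PowerSeries K) ^ m * eulerEval (Q m) f = 0

/-- The coefficient of zⁿ turns the operator equation into a recurrence, the form in which
factorials can be inserted or removed. -/
lemma isEulerFinite_iff_coeff (f : PowerSeries K) : f.IsEulerFinite ↔
    ∃ (M : ℕ) (Q : ℕ → K[X]), (∃ m ∈ Finset.range (M + 1), Q m ≠ 0) ∧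
      ∀ n, ∑ m ∈ Finset.range (M + 1), (if m ≤ n then
        (Q m).eval ((n - m : ℕ) : K) * PowerSeries.coeff (n - m) f else 0) = 0 := by
  unfold IsEulerFinite
  simp only [PowerSeries.ext_iff, map_sum, PowerSeries.coeff_X_pow_mul', coeff_eulerEval, map_zero]

lemma isDFinite_of_exists_ne_zero {f : PowerSeries K} (N : ℕ) (p : ℕ → K[X])
    (hp : ∃ i ∈ Finset.range N, p i ≠ 0)
    (h : ∑ i ∈ Finset.range N, (p i : PowerSeries K) * (⇑(PowerSeries.derivative K))^[i] f = 0) :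
    f.IsDFinite := by
  classical
  induction N with
  | zero => simp at hp
  | succ N ih =>
    by_cases hN : p N = 0
    · refine ih ?_ ?_
      · obtain ⟨i, hi, hpi⟩ := hp
        refine ⟨i, ?_, hpi⟩
        have : i ≠ N := by rintro rfl; exact hpi hN
        simp at hi ⊢
        omega
      · simpa [Finset.sum_range_succ, hN] using h
    · exact ⟨N, p, hN, h⟩

lemma coeff_sum_C_mul_X_pow {N : ℕ} (c : ℕ → K) (i n : ℕ) (hn : n < N) :
    (∑ m ∈ Finset.range N, Polynomial.C (c m) * Polynomial.X ^ (m + i)).coeff (n + i) = c n := by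
  simp only [Polynomial.finsetSum_coeff, Polynomial.coeff_C_mul, Polynomial.coeff_X_pow,
    add_left_inj]
  simp [hn]

/-- The i-th falling factorial is monic of degree i, so the top coefficient can be removed
repeatedly. -/
lemma exists_eq_sum_descPochhammer (N : ℕ) (Q : K[X]) (hQ : Q.degree < N) :
    ∃ c : ℕ → K, Q = ∑ i ∈ Finset.range N, Polynomial.C (c i) * descPochhammer K i := by
  induction N generalizing Q with
  | zero => exact ⟨0, by simpa [Nat.WithBot.lt_zero_iff] using hQ⟩
  | succ N ih =>
    have hmon := monic_descPochhammer K N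
    have hdeg : (descPochhammer K N).natDegree = N := descPochhammer_natDegree K N
    obtain ⟨c, hc⟩ := ih (Q - Polynomial.C (Q.coeff N) * descPochhammer K N) (by
      rw [Polynomial.degree_lt_iff_coeff_zero] at hQ ⊢
      intro m hm
      rcases hm.eq_or_lt with rfl | hm
      · have : (descPochhammer K N).coeff N = 1 := by
          simpa [Polynomial.Monic, Polynomial.leadingCoeff, hdeg] using hmon
        simp [this]
      · rw [Polynomial.coeff_sub, hQ m hm, Polynomial.coeff_C_mul,
          Polynomial.coeff_eq_zero_of_natDegree_lt (p := descPochhammer K N) (by omega)]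
        simp)
    refine ⟨fun i => if i = N then Q.coeff N else c i, ?_⟩
    simp only [Finset.sum_range_succ, if_true]
    rw [← sub_eq_iff_eq_add, hc]
    refine Finset.sum_congr rfl fun i hi => ?_
    rw [if_neg (by simp at hi; omega)]

/-- Multiply the equation by zʳ, write zʳ pᵢ dⁱ = (zʳ⁻ⁱ pᵢ)(zⁱ dⁱ), and sort by powers of z. -/
theorem IsDFinite.isEulerFinite {f : PowerSeries K} (hf : f.IsDFinite) : f.IsEulerFinite := by
  obtain ⟨r, p, hpr, h⟩ := hf
  set P : ℕ → K[X] := fun i => Polynomial.X ^ (r - i) * p i with hP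
  set M := (Finset.range (r + 1)).sup fun i => (P i).natDegree with hM
  have hPM : ∀ i ∈ Finset.range (r + 1), (P i).natDegree < M + 1 := fun i hi =>
    Nat.lt_succ_of_le (Finset.le_sup (f := fun i => (P i).natDegree) hi)
  refine ⟨M, fun m => ∑ i ∈ Finset.range (r + 1),
    Polynomial.C ((P i).coeff m) * descPochhammer K i, ?_, ?_⟩
  · have hPr : P r = p r := by simp [hP]
    refine ⟨(P r).natDegree, by simpa using hPM r (by simp), fun h0 => ?_⟩
    -- Only the falling factorial of order r reaches degree r, so this coefficient is the leading
    -- coefficient of `p r`.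
    have := congrArg (fun q => q.coeff r) h0
    simp only [Polynomial.finsetSum_coeff, Polynomial.coeff_C_mul, Polynomial.coeff_zero] at this
    rw [Finset.sum_range_succ] at this
    rw [Finset.sum_eq_zero, zero_add] at this
    · have hmon := monic_descPochhammer K r
      rw [Polynomial.Monic, Polynomial.leadingCoeff, descPochhammer_natDegree] at hmon
      rw [hmon, mul_one, Polynomial.coeff_natDegree, Polynomial.leadingCoeff_eq_zero, hPr] at this
      exact hpr this
    · intro i hi
      rw [Polynomial.coeff_eq_zero_of_natDegree_lt (p := descPochhammer K i) (by
        rw [descPochhammer_natDegree]; simpa using hi), mul_zero]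
  · have key : ∀ i ∈ Finset.range (r + 1),
        ∑ m ∈ Finset.range (M + 1), (PowerSeries.X : PowerSeries K) ^ m *
          (PowerSeries.C ((P i).coeff m) * eulerEval (descPochhammer K i) f)
        = (PowerSeries.X : PowerSeries K) ^ r *
          ((p i : PowerSeries K) * (⇑(PowerSeries.derivative K))^[i] f) := by
      intro i hi
      have h1 : ((P i : K[X]) : PowerSeries K) = ∑ m ∈ Finset.range (M + 1),
          PowerSeries.C ((P i).coeff m) * PowerSeries.X ^ m := by
        conv_lhs => rw [Polynomial.as_sum_range_C_mul_X_pow' (P i) (hPM i hi)]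
        rw [← Polynomial.coeToPowerSeries.ringHom_apply, map_sum]
        simp
      have h2 : ((P i : K[X]) : PowerSeries K) = PowerSeries.X ^ (r - i) * (p i : PowerSeries K) := by
        simp [hP]
      have h3 : r = (r - i) + i := by simp at hi; omega
      calc _ = ((P i : K[X]) : PowerSeries K) * eulerEval (descPochhammer K i) f := by
            rw [h1, Finset.sum_mul]
            exact Finset.sum_congr rfl fun m _ => by ring
        _ = _ := by
            rw [h2, eulerEval_descPochhammer]
            conv_rhs => rw [h3, pow_add]
            ring
    simp only [eulerEval_sum, eulerEval_C_mul, Finset.mul_sum]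
    rw [Finset.sum_comm, Finset.sum_congr rfl key, ← Finset.mul_sum, h, mul_zero]

theorem IsEulerFinite.isDFinite {f : PowerSeries K} (hf : f.IsEulerFinite) : f.IsDFinite := by
  obtain ⟨M, Q, ⟨m₀, hm₀, hQ⟩, h⟩ := hf
  set N := (Finset.range (M + 1)).sup (fun m => (Q m).natDegree) + 1 with hN
  have hdeg : ∀ m ∈ Finset.range (M + 1), (Q m).degree < N := fun m hm =>
    lt_of_le_of_lt Polynomial.degree_le_natDegree (by
      exact_mod_cast Nat.lt_succ_of_le (Finset.le_sup (f := fun i => (Q i).natDegree) hm))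
  have : ∀ m, ∃ c : ℕ → K, m ∈ Finset.range (M + 1) →
      Q m = ∑ i ∈ Finset.range N, Polynomial.C (c i) * descPochhammer K i := by
    intro m
    by_cases hm : m ∈ Finset.range (M + 1)
    · obtain ⟨c, hc⟩ := exists_eq_sum_descPochhammer N (Q m) (hdeg m hm)
      exact ⟨c, fun _ => hc⟩
    · exact ⟨0, fun h => absurd h hm⟩
  choose c hc using this
  refine isDFinite_of_exists_ne_zero N (fun i => ∑ m ∈ Finset.range (M + 1),
    Polynomial.C (c m i) * Polynomial.X ^ (m + i)) ?_ ?_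
  · by_contra! hcon
    refine hQ ?_
    rw [hc m₀ hm₀]
    refine Finset.sum_eq_zero fun i hi => ?_
    -- For fixed `i` the exponents `m + i` are distinct, so nothing cancels: `c m₀ i` is a
    -- coefficient of the `i`-th polynomial.
    rw [← coeff_sum_C_mul_X_pow (N := M + 1) (fun m => c m i) i m₀ (by simpa using hm₀), hcon i hi]
    simp
  · rw [← h]
    have : ∀ m ∈ Finset.range (M + 1), (PowerSeries.X : PowerSeries K) ^ m * eulerEval (Q m) f =
        ∑ i ∈ Finset.range N, PowerSeries.C (c m i) * PowerSeries.X ^ (m + i) *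
          (⇑(PowerSeries.derivative K))^[i] f := by
      intro m hm
      conv_lhs => rw [hc m hm]
      rw [eulerEval_sum, Finset.mul_sum]
      refine Finset.sum_congr rfl fun i _ => ?_
      rw [eulerEval_C_mul, eulerEval_descPochhammer, pow_add]
      ring
    rw [Finset.sum_congr rfl this, Finset.sum_comm]
    refine Finset.sum_congr rfl fun i _ => ?_
    rw [← Finset.sum_mul, ← Polynomial.coeToPowerSeries.ringHom_apply, map_sum]
    simp

theorem isDFinite_iff_isEulerFinite (f : PowerSeries K) : f.IsDFinite ↔ f.IsEulerFinite :=
  ⟨IsDFinite.isEulerFinite, IsEulerFinite.isDFinite⟩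

/-! ### Passing between ordinary and exponential generating functions. -/

/-- The exponential generating function of the coefficients of a power series. -/
noncomputable def borel (f : PowerSeries K) : PowerSeries K :=
  PowerSeries.mk fun n => PowerSeries.coeff n f / (n.factorial : K)

lemma coeff_borel (f : PowerSeries K) (n : ℕ) :
    PowerSeries.coeff n (borel f) = PowerSeries.coeff n f / (n.factorial : K) := by
  simp [borel]

variable [CharZero K]

theorem IsDFinite.borel {f : PowerSeries K} (hf : f.IsDFinite) : (borel f).IsDFinite := by
  rw [isDFinite_iff_isEulerFinite, isEulerFinite_iff_coeff] at hf ⊢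
  obtain ⟨M, Q, ⟨m₀, hm₀, hQ⟩, h⟩ := hf
  -- Multiply the recurrence at `n` by n(n-1)⋯(n-M+1)/n!. Dividing n! by (n-m)! uses up the first m
  -- factors; the other M-m form a falling factorial of n-m. For n < M the multiplier is zero.
  refine ⟨M, fun m => Q m * descPochhammer K (M - m), ⟨m₀, hm₀,
    mul_ne_zero hQ (monic_descPochhammer K _).ne_zero⟩, fun n => ?_⟩
  refine Eq.trans ?_ ((congrArg (((n.descFactorial M : K) / n.factorial) * ·) (h n)).trans
    (mul_zero _))
  simp only [Finset.mul_sum]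
  refine Finset.sum_congr rfl fun m hm => ?_
  split_ifs with hmn
  · have h1 : n.descFactorial M = n.descFactorial m * (n - m).descFactorial (M - m) := by
      rw [mul_comm]
      exact (Nat.descFactorial_mul_descFactorial (by simp at hm; omega)).symm
    have h2 : (n.factorial : K) = (n - m).factorial * n.descFactorial m := by
      exact_mod_cast (Nat.factorial_mul_descFactorial hmn).symm
    have h3 : (n.descFactorial m : K) ≠ 0 := by
      exact_mod_cast (Nat.descFactorial_pos.2 hmn).ne'
    have h4 : ((n - m).factorial : K) ≠ 0 := by exact_mod_cast Nat.factorial_ne_zero _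
    rw [Polynomial.eval_mul, descPochhammer_eval_eq_descFactorial, coeff_borel, h1, h2]
    push_cast
    field_simp
  · rw [mul_zero]

theorem IsDFinite.of_borel {f : PowerSeries K} (hf : (PowerSeries.borel f).IsDFinite) :
    f.IsDFinite := by
  rw [isDFinite_iff_isEulerFinite, isEulerFinite_iff_coeff] at hf ⊢
  obtain ⟨M, Q, ⟨m₀, hm₀, hQ⟩, h⟩ := hf
  -- Multiply the recurrence by n!: the factor n!/(n-m)! = n(n-1)⋯(n-m+1) has to be a polynomial in
  -- n-m, whence the shift by `m`.
  refine ⟨M, fun m => Q m * (descPochhammer K m).comp (Polynomial.X + Polynomial.C (m : K)),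
    ⟨m₀, hm₀, mul_ne_zero hQ ?_⟩, fun n => ?_⟩
  · exact ((monic_descPochhammer K _).comp_X_add_C _).ne_zero
  refine Eq.trans ?_ ((congrArg ((n.factorial : K) * ·) (h n)).trans (mul_zero _))
  simp only [Finset.mul_sum]
  refine Finset.sum_congr rfl fun m hm => ?_
  split_ifs with hmn
  · have h2 : (n.factorial : K) = (n - m).factorial * n.descFactorial m := by
      exact_mod_cast (Nat.factorial_mul_descFactorial hmn).symm
    have h4 : ((n - m).factorial : K) ≠ 0 := by exact_mod_cast Nat.factorial_ne_zero _
    have h5 : ((n - m : ℕ) : K) + m = (n : K) := by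
      rw [← Nat.cast_add, Nat.sub_add_cancel hmn]
    rw [Polynomial.eval_mul, Polynomial.eval_comp, Polynomial.eval_add, Polynomial.eval_X,
      Polynomial.eval_C, h5, descPochhammer_eval_eq_descFactorial, coeff_borel, h2]
    field_simp
  · rw [mul_zero]

end PowerSeries

/-! ### Products of D-finite series, and D-finiteness of algebraic series. -/

namespace PowerSeries

instance faithfulSMul_polynomial (K : Type*) [Field K] : FaithfulSMul K[X] K⟦X⟧ := by
  rw [faithfulSMul_iff_algebraMap_injective]
  intro a b h
  rw [PowerSeries.algebraMap_apply', PowerSeries.algebraMap_apply'] at h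
  simpa using h

section FiniteDimensional

set_option linter.unusedSectionVars false

variable {K : Type*} [Field K] {E V : Type*} [Field E] [Algebra K[X] E] [IsFractionRing K[X] E]
  [Field V] [Algebra K⟦X⟧ V] [FaithfulSMul K⟦X⟧ V] [Algebra K[X] V] [Algebra E V]
  [IsScalarTower K[X] E V] [IsScalarTower K[X] K⟦X⟧ V]

lemma smul_eq_coe_mul (a : K[X]) (f : K⟦X⟧) : a • f = (a : K⟦X⟧) * f := by
  rw [Algebra.smul_def, PowerSeries.algebraMap_apply']
  simp

lemma derivative_smul (a : K[X]) (f : K⟦X⟧) : PowerSeries.derivative K (a • f)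
    = Polynomial.derivative a • f + a • PowerSeries.derivative K f := by
  rw [smul_eq_coe_mul, Derivation.leibniz, PowerSeries.derivative_coe, smul_eq_coe_mul,
    smul_eq_coe_mul, smul_eq_mul, smul_eq_mul]
  ring

lemma algebraMap_smul_fractionRing (a : K[X]) (f : K⟦X⟧) :
    algebraMap K⟦X⟧ V (a • f) = algebraMap K[X] E a • algebraMap K⟦X⟧ V f := by
  rw [Algebra.smul_def, map_mul, Algebra.smul_def, ← IsScalarTower.algebraMap_apply,
    ← IsScalarTower.algebraMap_apply]

lemma mem_of_smul_mem {W : Submodule E V} {a : K[X]} (ha : a ≠ 0) {f : K⟦X⟧}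
    (h : algebraMap K⟦X⟧ V (a • f) ∈ W) : algebraMap K⟦X⟧ V f ∈ W := by
  rw [algebraMap_smul_fractionRing (E := E)] at h
  have hne : algebraMap K[X] E a ≠ 0 := by simpa using ha
  exact (W.smul_mem_iff hne).1 h

lemma smul_mem_of_mem {W : Submodule E V} (a : K[X]) {f : K⟦X⟧}
    (h : algebraMap K⟦X⟧ V f ∈ W) : algebraMap K⟦X⟧ V (a • f) ∈ W := by
  rw [algebraMap_smul_fractionRing (E := E)]
  exact W.smul_mem _ h

/-- Here `E` is K(z) and `V` a field containing K⟦z⟧. One derivative more than the dimension forces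
a linear relation over `E`; clearing denominators makes it polynomial. -/
theorem isDFinite_of_forall_mem {f : K⟦X⟧} (W : Submodule E V) [FiniteDimensional E W]
    (h : ∀ i, algebraMap K⟦X⟧ V ((⇑(PowerSeries.derivative K))^[i] f) ∈ W) : f.IsDFinite := by
  let N := Module.finrank E W + 1
  let b : Fin N → K⟦X⟧ := fun i => (⇑(PowerSeries.derivative K))^[i] f
  have hdep : ¬ LinearIndependent K[X] (fun i => algebraMap K⟦X⟧ V (b i)) := by
    intro hli
    rw [LinearIndependent.iff_fractionRing K[X] E] at hli
    have hli' : LinearIndependent E (fun i => (⟨algebraMap K⟦X⟧ V (b i), h i⟩ : W)) :=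
      LinearIndependent.of_comp W.subtype (by simpa [Function.comp_def] using! hli)
    have := hli'.fintype_card_le_finrank
    simp [N] at this
  rw [Fintype.not_linearIndependent_iff] at hdep
  obtain ⟨c, hc, i, hi⟩ := hdep
  have hsum : ∑ i, c i • b i = 0 := by
    apply FaithfulSMul.algebraMap_injective K⟦X⟧ V
    rw [map_zero, ← hc, map_sum]
    refine Finset.sum_congr rfl fun i _ => ?_
    rw [algebraMap_smul_fractionRing (E := E), algebraMap_smul]
  refine isDFinite_of_exists_ne_zero N (fun j => if hj : j < N then c ⟨j, hj⟩ else 0)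
    ⟨i, by simp, by simpa using hi⟩ ?_
  rw [Finset.sum_range, ← hsum]
  refine Finset.sum_congr rfl fun i _ => ?_
  simp [b, smul_eq_coe_mul]

variable (E V) in
-- The first `r` derivatives span `W`. The derivation is not extended to `V`; instead denominators
-- are tracked in the K[z]-span `S`, which `p r` times the derivation preserves.
theorem IsDFinite.exists_submodule {f : K⟦X⟧} (hf : f.IsDFinite) :
    ∃ W : Submodule E V, FiniteDimensional E W ∧
      ∀ i, algebraMap K⟦X⟧ V ((⇑(PowerSeries.derivative K))^[i] f) ∈ W := by
  obtain ⟨r, p, hp, h⟩ := hf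
  let D : ℕ → K⟦X⟧ := fun i => (⇑(PowerSeries.derivative K))^[i] f
  have hD : ∀ i, PowerSeries.derivative K (D i) = D (i + 1) := fun i =>
    (Function.iterate_succ_apply' _ _ _).symm
  let S : Submodule K[X] K⟦X⟧ := Submodule.span K[X] (D '' Set.Iio r)
  have hS : ∀ i < r, D i ∈ S := fun i hi => Submodule.subset_span ⟨i, hi, rfl⟩
  have hr : p r • D r ∈ S := by
    rw [Finset.sum_range_succ] at h
    have : p r • D r = - ∑ i ∈ Finset.range r, p i • D i := by
      simp only [smul_eq_coe_mul, D]
      linear_combination h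
    rw [this]
    exact S.neg_mem (S.sum_mem fun i hi => S.smul_mem _ (hS i (by simpa using hi)))
  have hder : ∀ g ∈ S, p r • PowerSeries.derivative K g ∈ S := by
    intro g hg
    induction hg using Submodule.span_induction with
    | mem x hx =>
      obtain ⟨i, hi, rfl⟩ := hx
      rw [hD]
      rcases Nat.lt_or_eq_of_le (Nat.succ_le_of_lt hi) with hi | hi
      · exact S.smul_mem _ (hS _ hi)
      · change i + 1 = r at hi
        rw [hi]; exact hr
    | zero => simp
    | add x y _ _ hx hy => rw [map_add, smul_add]; exact S.add_mem hx hy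
    | smul a x hx' hx =>
      rw [derivative_smul, smul_add, smul_comm (p r) a]
      exact S.add_mem (S.smul_mem _ (S.smul_mem _ hx')) (S.smul_mem _ hx)
  have hex : ∀ i, ∃ c : K[X], c ≠ 0 ∧ c • D i ∈ S := by
    intro i
    induction i with
    | zero =>
      rcases Nat.eq_zero_or_pos r with h0 | h0
      · exact ⟨p r, hp, by simpa [h0] using hr⟩
      · exact ⟨1, one_ne_zero, by simpa using hS 0 h0⟩
    | succ i ih =>
      obtain ⟨c, hc, hm⟩ := ih
      -- Differentiating `c • D i` and scaling by `p r` leaves the extra term p_r c' D_i; the second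
      -- factor `c` makes it a multiple of `c • D i`, which lies in `S`.
      refine ⟨p r * c * c, mul_ne_zero (mul_ne_zero hp hc) hc, ?_⟩
      have : (p r * c * c) • D (i + 1) = c • (p r • PowerSeries.derivative K (c • D i))
          - (p r * Polynomial.derivative c) • (c • D i) := by
        rw [derivative_smul, hD]
        simp only [smul_add, smul_smul]
        rw [show p r * Polynomial.derivative c * c = c * (p r * Polynomial.derivative c) by ring,
          add_sub_cancel_left]
        congr 1
        ring
      rw [this]
      exact S.sub_mem (S.smul_mem _ (hder _ hm)) (S.smul_mem _ hm)
  refine ⟨Submodule.span E ((fun i => algebraMap K⟦X⟧ V (D i)) '' Set.Iio r),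
    FiniteDimensional.span_of_finite E ((Set.finite_Iio r).image _), fun i => ?_⟩
  obtain ⟨c, hc, hm⟩ := hex i
  refine mem_of_smul_mem hc ?_
  change algebraMap K⟦X⟧ V (c • D i) ∈ _
  generalize c • D i = y at hm
  induction hm using Submodule.span_induction with
  | mem x hx =>
    obtain ⟨j, hj, rfl⟩ := hx
    exact Submodule.subset_span ⟨j, hj, rfl⟩
  | zero => simp
  | add x y _ _ hx hy => rw [map_add]; exact Submodule.add_mem _ hx hy
  | smul a x _ hx => exact smul_mem_of_mem a hx

/-- Leibniz: both f g' and f' g again satisfy the hypotheses, so the induction runs over all pairs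
and avoids binomial coefficients. -/
lemma forall_mem_mul {f g : K⟦X⟧} {W₁ W₂ : Submodule E V}
    (hf : ∀ i, algebraMap K⟦X⟧ V ((⇑(PowerSeries.derivative K))^[i] f) ∈ W₁)
    (hg : ∀ i, algebraMap K⟦X⟧ V ((⇑(PowerSeries.derivative K))^[i] g) ∈ W₂) (i : ℕ) :
    algebraMap K⟦X⟧ V ((⇑(PowerSeries.derivative K))^[i] (f * g)) ∈ W₁ * W₂ := by
  induction i generalizing f g with
  | zero =>
    rw [Function.iterate_zero_apply, map_mul]
    exact Submodule.mul_mem_mul (hf 0) (hg 0)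
  | succ i ih =>
    have hsum : (⇑(PowerSeries.derivative K))^[i + 1] (f * g)
        = (⇑(PowerSeries.derivative K))^[i] (f * PowerSeries.derivative K g)
          + (⇑(PowerSeries.derivative K))^[i] (PowerSeries.derivative K f * g) := by
      rw [Function.iterate_succ_apply, Derivation.leibniz, ← iterate_map_add]
      simp [mul_comm]
    rw [hsum, map_add]
    exact Submodule.add_mem _ (ih hf fun j => hg (j + 1)) (ih (fun j => hf (j + 1)) hg)

/-- Chain rule; `q` arises by differentiating the coefficients of `m`. -/
lemma derivative_aeval (g : K⟦X⟧) (m : K[X][X]) :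
    ∃ q : K[X][X], PowerSeries.derivative K (Polynomial.aeval g m)
      = Polynomial.aeval g q + Polynomial.aeval g (Polynomial.derivative m) * PowerSeries.derivative K g := by
  induction m using Polynomial.induction_on' with
  | add a b ha hb =>
    obtain ⟨q, hq⟩ := ha
    obtain ⟨q', hq'⟩ := hb
    exact ⟨q + q', by simp only [map_add, hq, hq', add_mul]; ring⟩
  | monomial n a =>
    refine ⟨Polynomial.monomial n (Polynomial.derivative a), ?_⟩
    rw [Polynomial.aeval_monomial, ← Algebra.smul_def, derivative_smul,
      Polynomial.aeval_monomial, Polynomial.derivative_monomial, Polynomial.aeval_monomial,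
      Algebra.smul_def, Derivation.leibniz_pow, Algebra.smul_def, map_mul]
    simp only [smul_eq_mul, nsmul_eq_mul, map_natCast]
    ring

/-- Take an annihilating polynomial of least degree: in characteristic zero its derivative is
nonzero of smaller degree. -/
lemma exists_aeval_eq_zero_aeval_derivative_ne_zero [CharZero K] {g : K⟦X⟧}
    (hg : IsAlgebraic K[X] g) :
    ∃ m : K[X][X], Polynomial.aeval g m = 0 ∧ Polynomial.aeval g (Polynomial.derivative m) ≠ 0 := by
  classical
  have hex : ∃ n, ∃ m : K[X][X], m ≠ 0 ∧ Polynomial.aeval g m = 0 ∧ m.natDegree = n := by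
    obtain ⟨m, hm, h⟩ := hg
    exact ⟨_, m, hm, h, rfl⟩
  obtain ⟨m, hm, h, hn⟩ := Nat.find_spec hex
  refine ⟨m, h, fun h' => ?_⟩
  have hpos : m.natDegree ≠ 0 := by
    intro h0
    rw [Polynomial.eq_C_of_natDegree_eq_zero h0, Polynomial.aeval_C,
      FaithfulSMul.algebraMap_eq_zero_iff] at h
    rw [Polynomial.eq_C_of_natDegree_eq_zero h0, h] at hm
    simp at hm
  have hd : Polynomial.derivative m ≠ 0 := by
    intro h0
    exact hpos (Polynomial.derivative_eq_zero.1 h0)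
  refine Nat.find_min hex (m := (Polynomial.derivative m).natDegree) ?_ ⟨_, hd, h', rfl⟩
  rw [← hn]
  exact Polynomial.natDegree_derivative_lt hpos

/-- Differentiating m(g) = 0 and solving for g' expresses it rationally in g. -/
theorem derivative_mem_of_isAlgebraic [CharZero K] (F : IntermediateField E V) {g : K⟦X⟧}
    (halg : IsAlgebraic K[X] g) (hg : algebraMap K⟦X⟧ V g ∈ F) :
    algebraMap K⟦X⟧ V (PowerSeries.derivative K g) ∈ F := by
  have haeval : ∀ q : K[X][X], algebraMap K⟦X⟧ V (Polynomial.aeval g q) ∈ F := by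
    intro q
    induction q using Polynomial.induction_on' with
    | add a b ha hb => rw [map_add, map_add]; exact add_mem ha hb
    | monomial n a =>
      rw [Polynomial.aeval_monomial, map_mul, map_pow, ← IsScalarTower.algebraMap_apply,
        IsScalarTower.algebraMap_apply K[X] E V]
      exact mul_mem (F.algebraMap_mem _) (pow_mem hg _)
  obtain ⟨m, hm, hm'⟩ := exists_aeval_eq_zero_aeval_derivative_ne_zero halg
  obtain ⟨q, hq⟩ := derivative_aeval g m
  rw [hm, map_zero] at hq
  have hne : algebraMap K⟦X⟧ V (Polynomial.aeval g (Polynomial.derivative m)) ≠ 0 := by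
    simpa using hm'
  have : algebraMap K⟦X⟧ V (PowerSeries.derivative K g) =
      - algebraMap K⟦X⟧ V (Polynomial.aeval g q) / algebraMap K⟦X⟧ V (Polynomial.aeval g (Polynomial.derivative m)) := by
    rw [eq_div_iff hne, ← map_mul, ← map_neg]
    congr 1
    linear_combination -hq
  rw [this]
  exact div_mem (neg_mem (haeval _)) (haeval _)

end FiniteDimensional

variable {K : Type*} [Field K]

theorem isDFinite_mul_of_fractionField (E V : Type*) [Field E] [Algebra K[X] E] [IsFractionRing K[X] E]
    [Field V] [Algebra K⟦X⟧ V] [FaithfulSMul K⟦X⟧ V] [Algebra K[X] V] [Algebra E V]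
    [IsScalarTower K[X] E V] [IsScalarTower K[X] K⟦X⟧ V]
    {f g : K⟦X⟧} (hf : f.IsDFinite) (hg : g.IsDFinite) :
    (f * g).IsDFinite := by
  obtain ⟨W₁, _, h₁⟩ := hf.exists_submodule E V
  obtain ⟨W₂, _, h₂⟩ := hg.exists_submodule E V
  have : FiniteDimensional E ↥(W₁ * W₂) :=
    Module.Finite.iff_fg.2 ((Module.Finite.iff_fg.1 ‹_›).mul (Module.Finite.iff_fg.1 ‹_›))
  exact isDFinite_of_forall_mem (W₁ * W₂) (forall_mem_mul h₁ h₂)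

/-- The field E(f) is finite-dimensional over `E` and contains all derivatives of f. -/
theorem isDFinite_of_isAlgebraic_fractionField [CharZero K] (E V : Type*) [Field E] [Algebra K[X] E] [IsFractionRing K[X] E]
    [Field V] [Algebra K⟦X⟧ V] [FaithfulSMul K⟦X⟧ V] [Algebra K[X] V] [Algebra E V]
    [IsScalarTower K[X] E V] [IsScalarTower K[X] K⟦X⟧ V]
    {f : K⟦X⟧}
    (hf : IsAlgebraic K[X] f) : f.IsDFinite := by
  have halg : ∀ g : K⟦X⟧, IsAlgebraic K[X] g ↔ IsAlgebraic E (algebraMap K⟦X⟧ V g) := fun g => by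
    rw [← IsFractionRing.isAlgebraic_iff K[X] E V,
      isAlgebraic_algebraMap_iff (FaithfulSMul.algebraMap_injective K⟦X⟧ V)]
  let F := IntermediateField.adjoin E {algebraMap K⟦X⟧ V f}
  have hfin : FiniteDimensional E F :=
    IntermediateField.adjoin.finiteDimensional ((halg f).1 hf).isIntegral
  have hfin' : FiniteDimensional E (Subalgebra.toSubmodule F.toSubalgebra) := hfin
  refine isDFinite_of_forall_mem (Subalgebra.toSubmodule F.toSubalgebra) fun i => ?_
  change algebraMap K⟦X⟧ V _ ∈ F
  induction i with
  | zero => exact IntermediateField.mem_adjoin_simple_self E _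
  | succ i ih =>
    rw [Function.iterate_succ_apply']
    refine derivative_mem_of_isAlgebraic F ((halg _).2 ?_) ih
    exact (IsAlgebraic.of_finite E (⟨_, ih⟩ : F)).algebraMap (A := V)


theorem IsDFinite.mul {f g : K⟦X⟧} (hf : f.IsDFinite) (hg : g.IsDFinite) : (f * g).IsDFinite := by
  have : FaithfulSMul K[X] (FractionRing K⟦X⟧) := FaithfulSMul.trans K[X] K⟦X⟧ _
  let _ := FractionRing.liftAlgebra K[X] (FractionRing K⟦X⟧)
  exact isDFinite_mul_of_fractionField (FractionRing K[X]) (FractionRing K⟦X⟧) hf hg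

theorem isDFinite_of_isAlgebraic [CharZero K] {f : K⟦X⟧} (hf : IsAlgebraic K[X] f) :
    f.IsDFinite := by
  have : FaithfulSMul K[X] (FractionRing K⟦X⟧) := FaithfulSMul.trans K[X] K⟦X⟧ _
  let _ := FractionRing.liftAlgebra K[X] (FractionRing K⟦X⟧)
  exact isDFinite_of_isAlgebraic_fractionField (FractionRing K[X]) (FractionRing K⟦X⟧) hf

end PowerSeries

/-! ### The Jacobian criterion for algebraicity. -/

section JacobianCriterion

lemma Derivation.mvPolynomial_aeval {R F ι : Type*} [CommRing R] [CommRing F] [Algebra R F]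
    [Fintype ι] (d : Derivation R F F) (f : ι → F) (q : MvPolynomial ι R) :
    d (MvPolynomial.aeval f q)
      = ∑ j, MvPolynomial.aeval f (MvPolynomial.pderiv j q) * d (f j) := by
  classical
  induction q using MvPolynomial.induction_on with
  | C a => simp
  | add p q hp hq => simp [hp, hq, add_mul, Finset.sum_add_distrib]
  | mul_X p i hp =>
    simp only [map_mul, MvPolynomial.aeval_X, Derivation.leibniz, smul_eq_mul, hp,
      MvPolynomial.pderiv_X, map_add, add_mul, Finset.sum_add_distrib, Finset.mul_sum]
    congr 1
    · rw [Finset.sum_eq_single i]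
      · simp
      · intro j _ hj
        simp [hj.symm]
      · simp
    · exact Finset.sum_congr rfl fun j _ => by ring

/-- An `E`-derivation applied to the system gives a vector killed by the Jacobian. So it vanishes on
the generators `f`, hence everywhere, and `F` is unramified, thus separable, over `E`. -/
theorem Algebra.IsAlgebraic.of_det_pderiv_ne_zero {E F ι : Type*} [Field E] [CharZero E] [Field F]
    [Algebra E F] [Fintype ι] [DecidableEq ι] (p : ι → MvPolynomial ι E) (f : ι → F)
    (hp : ∀ i, MvPolynomial.aeval f (p i) = 0)
    (hdet : (Matrix.of fun i j =>
      MvPolynomial.aeval f (MvPolynomial.pderiv j (p i))).det ≠ 0)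
    (htop : IntermediateField.adjoin E (Set.range f) = ⊤) : Algebra.IsAlgebraic E F := by
  have hd : ∀ d : Derivation E F F, d = 0 := by
    intro d
    have h0 : (fun j => d (f j)) = 0 := by
      by_contra hne
      refine hdet (Matrix.exists_mulVec_eq_zero_iff.1 ⟨fun j => d (f j), hne, ?_⟩)
      ext i
      simp only [Matrix.mulVec, dotProduct, Matrix.of_apply, Pi.zero_apply]
      rw [← Derivation.mvPolynomial_aeval, hp, map_zero]
    ext x
    have hx : x ∈ IntermediateField.adjoin E (Set.range f) := htop ▸ IntermediateField.mem_top
    induction hx using IntermediateField.adjoin_induction with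
    | mem x hx =>
      obtain ⟨j, rfl⟩ := hx
      exact congrFun h0 j
    | algebraMap x => simp
    | add x y _ _ hx hy => simp_all
    | inv x _ hx => rw [Derivation.leibniz_inv, hx]; simp
    | mul x y _ _ hx hy => rw [Derivation.leibniz, hx, hy]; simp
  -- Derivations into `F` are the dual of the space of differentials; over a field a space with zero
  -- dual is zero.
  have hsub : Subsingleton (Ω[F⁄E]) := by
    refine subsingleton_of_forall_eq 0 fun w => ?_
    rw [← Module.forall_dual_apply_eq_zero_iff F]
    intro φ
    have := hd (φ.compDer (KaehlerDifferential.D E F))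
    have hφ : φ = 0 := by
      apply Derivation.liftKaehlerDifferential_unique
      rw [this]
      ext
      simp
    rw [hφ, LinearMap.zero_apply]
  have : Algebra.FormallyUnramified E F := ⟨hsub⟩
  have : Algebra.EssFiniteType E F := by
    rw [← IntermediateField.fg_top_iff, ← htop]
    exact IntermediateField.fg_adjoin_of_finite (Set.finite_range f)
  have := Algebra.FormallyUnramified.isSeparable E F
  infer_instance

theorem isAlgebraic_of_det_pderiv_ne_zero_of_field {E V ι : Type*} [Field E] [CharZero E] [Field V]
    [Algebra E V] [Fintype ι] [DecidableEq ι] (p : ι → MvPolynomial ι E) (f : ι → V)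
    (hp : ∀ i, MvPolynomial.aeval f (p i) = 0)
    (hdet : (Matrix.of fun i j =>
      MvPolynomial.aeval f (MvPolynomial.pderiv j (p i))).det ≠ 0) (i : ι) :
    IsAlgebraic E (f i) := by
  let F := IntermediateField.adjoin E (Set.range f)
  let g : ι → F := fun j => ⟨f j, IntermediateField.subset_adjoin _ _ ⟨j, rfl⟩⟩
  have hfg : ∀ q : MvPolynomial ι E, MvPolynomial.aeval f q = F.val (MvPolynomial.aeval g q) :=
    fun q => (MvPolynomial.comp_aeval_apply (f := g) F.val q).symm
  have halg : Algebra.IsAlgebraic E F := by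
    refine Algebra.IsAlgebraic.of_det_pderiv_ne_zero p g (fun j => ?_) (fun h0 => hdet ?_) ?_
    · have := hp j
      rw [hfg] at this
      simpa using this
    · have := congrArg F.val h0
      rw [map_zero, AlgHom.map_det] at this
      rw [← this]
      congr 1
      ext a b
      simp [hfg]
    · apply IntermediateField.map_injective F.val
      rw [IntermediateField.adjoin_map, ← Set.range_comp, ← AlgHom.fieldRange_eq_map,
        IntermediateField.fieldRange_val]
      rfl
  exact (halg.isAlgebraic (g i)).algebraMap (A := V)

/-- If `f` solves a polynomial system whose Jacobian determinant does not vanish at `f`, then the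
components of `f` are algebraic over the coefficient ring. -/
theorem isAlgebraic_of_det_pderiv_ne_zero {A P ι : Type*} [CommRing A] [IsDomain A] [CharZero A]
    [CommRing P] [IsDomain P] [Algebra A P] [FaithfulSMul A P] [Fintype ι] [DecidableEq ι]
    (p : ι → MvPolynomial ι A) (f : ι → P) (hp : ∀ i, MvPolynomial.aeval f (p i) = 0)
    (hdet : (Matrix.of fun i j =>
      MvPolynomial.aeval f (MvPolynomial.pderiv j (p i))).det ≠ 0) (i : ι) :
    IsAlgebraic A (f i) := by
  have : FaithfulSMul A (FractionRing P) := FaithfulSMul.trans A P _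
  let _ := FractionRing.liftAlgebra A (FractionRing P)
  have : CharZero (FractionRing A) :=
    charZero_of_injective_algebraMap (IsFractionRing.injective A (FractionRing A))
  let V := FractionRing P
  let q : ι → MvPolynomial ι (FractionRing A) :=
    fun j => MvPolynomial.map (algebraMap A (FractionRing A)) (p j)
  have hq : ∀ s : MvPolynomial ι A, MvPolynomial.aeval (fun j => algebraMap P V (f j))
      (MvPolynomial.map (algebraMap A (FractionRing A)) s)
        = algebraMap P V (MvPolynomial.aeval f s) := fun s => by
    rw [MvPolynomial.aeval_map_algebraMap]
    exact MvPolynomial.aeval_algebraMap_apply V f s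
  have h := isAlgebraic_of_det_pderiv_ne_zero_of_field q (fun j => algebraMap P V (f j))
    (fun j => by rw [hq, hp, map_zero]) (fun h0 => hdet ?_) i
  · rw [← IsFractionRing.isAlgebraic_iff A (FractionRing A) V] at h
    exact (isAlgebraic_algebraMap_iff (IsFractionRing.injective P V)).1 h
  · apply IsFractionRing.injective P V
    rw [map_zero, RingHom.map_det, ← h0]
    congr 1
    ext a b
    simp [q, MvPolynomial.pderiv_map, hq]

end JacobianCriterion

/-! ### Counting words under combination and renaming. -/

namespace Language

/-- The number of words of length `n`. -/
noncomputable def wordCount {T : Type*} (L : Language T) (n : ℕ) : ℕ :=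
  {w : List T | w ∈ L ∧ w.length = n}.ncard

lemma coeff_genFun {T : Type*} (L : Language T) (n : ℕ) :
    PowerSeries.coeff n L.genFun = (L.wordCount n : ℚ) := by
  simp [genFun, wordCount]

/-- Words of `L` obtained by combining words of `L₁` and `L₂`, when both words can be recovered
from the result and the number of results depends on the lengths only. -/
lemma wordCount_of_combine {A B T : Type*} {L₁ : Language A} {L₂ : Language B} {L : Language T}
    (op : List A → List B → Set (List T)) (c : ℕ → ℕ → ℕ) (h₁ : L₁.IsProper) (h₂ : L₂.IsProper)
    (hL : ∀ w, w ∈ L ↔ ∃ w₁ ∈ L₁, ∃ w₂ ∈ L₂, w ∈ op w₁ w₂)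
    (hlen : ∀ w₁ ∈ L₁, ∀ w₂ ∈ L₂, ∀ w ∈ op w₁ w₂, w.length = w₁.length + w₂.length)
    (hfin : ∀ w₁ ∈ L₁, ∀ w₂ ∈ L₂, (op w₁ w₂).Finite)
    (hcard : ∀ w₁ ∈ L₁, ∀ w₂ ∈ L₂, (op w₁ w₂).ncard = c w₁.length w₂.length)
    (hinj : ∀ w₁ ∈ L₁, ∀ w₂ ∈ L₂, ∀ w₁' ∈ L₁, ∀ w₂' ∈ L₂, ∀ w, w ∈ op w₁ w₂ → w ∈ op w₁' w₂' →
      w₁ = w₁' ∧ w₂ = w₂') :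
    L.IsProper ∧ ∀ n, L.wordCount n = ∑ p ∈ Finset.HasAntidiagonal.antidiagonal n,
      c p.1 p.2 * (L₁.wordCount p.1 * L₂.wordCount p.2) := by
  classical
  -- The default `∅` never matters: `hfin` covers all pairs in `I p`.
  let R : List A × List B → Finset (List T) := fun q =>
    if h : (op q.1 q.2).Finite then h.toFinset else ∅
  let I : ℕ × ℕ → Finset (List A × List B) := fun p => (h₁ p.1).toFinset ×ˢ (h₂ p.2).toFinset
  have hI : ∀ p q, q ∈ I p ↔ (q.1 ∈ L₁ ∧ q.1.length = p.1) ∧ (q.2 ∈ L₂ ∧ q.2.length = p.2) := by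
    intro p q
    simp [I]
  have hR : ∀ p, ∀ q ∈ I p, ∀ w, w ∈ R q ↔ w ∈ op q.1 q.2 := by
    intro p q hq w
    have := (hI p q).1 hq
    simp [R, hfin q.1 this.1.1 q.2 this.2.1]
  have hset : ∀ n, {w : List T | w ∈ L ∧ w.length = n} =
      ↑(((Finset.HasAntidiagonal.antidiagonal n).biUnion I).biUnion R) := by
    intro n
    ext w
    simp only [Set.mem_ofPred_eq, Finset.coe_biUnion, Finset.mem_coe, Set.mem_iUnion,
      Finset.HasAntidiagonal.mem_antidiagonal, exists_prop]
    constructor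
    · rintro ⟨hw, hn⟩
      obtain ⟨w₁, hw₁, w₂, hw₂, hw⟩ := (hL w).1 hw
      have hq : (w₁, w₂) ∈ I (w₁.length, w₂.length) := (hI _ _).2 ⟨⟨hw₁, rfl⟩, ⟨hw₂, rfl⟩⟩
      exact ⟨(w₁, w₂), ⟨_, by rw [← hn, hlen w₁ hw₁ w₂ hw₂ w hw], hq⟩, (hR _ _ hq w).2 hw⟩
    · rintro ⟨q, ⟨p, hp, hq⟩, hw⟩
      rw [hR p q hq] at hw
      obtain ⟨⟨hq₁, hl₁⟩, hq₂, hl₂⟩ := (hI p q).1 hq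
      exact ⟨(hL w).2 ⟨_, hq₁, _, hq₂, hw⟩, by rw [hlen _ hq₁ _ hq₂ w hw, hl₁, hl₂, hp]⟩
  refine ⟨fun n => by rw [hset]; exact Finset.finite_toSet _, fun n => ?_⟩
  rw [wordCount, hset, Set.ncard_coe_finset, Finset.card_biUnion, Finset.sum_biUnion]
  · refine Finset.sum_congr rfl fun p hp => ?_
    rw [Finset.sum_congr rfl (g := fun _ => c p.1 p.2)]
    · rw [Finset.sum_const, smul_eq_mul, mul_comm, Finset.card_product, wordCount, wordCount,
        Set.ncard_eq_toFinset_card _ (h₁ p.1), Set.ncard_eq_toFinset_card _ (h₂ p.2)]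
    · intro q hq
      obtain ⟨⟨hq₁, hl₁⟩, hq₂, hl₂⟩ := (hI p q).1 hq
      rw [← Set.ncard_coe_finset, ← hl₁, ← hl₂, ← hcard _ hq₁ _ hq₂]
      congr 1
      ext w
      exact hR p q hq w
  · intro p _ p' _ hne
    refine Finset.disjoint_left.2 fun q hq hq' => hne ?_
    obtain ⟨⟨_, hl₁⟩, _, hl₂⟩ := (hI p q).1 hq
    obtain ⟨⟨_, hl₁'⟩, _, hl₂'⟩ := (hI p' q).1 hq'
    exact Prod.ext (hl₁.symm.trans hl₁') (hl₂.symm.trans hl₂')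
  · intro q hq q' hq' hne
    refine Finset.disjoint_left.2 fun w hw hw' => hne ?_
    obtain ⟨p, _, hp⟩ := Finset.mem_biUnion.1 hq
    obtain ⟨p', _, hp'⟩ := Finset.mem_biUnion.1 hq'
    rw [hR p q hp] at hw
    rw [hR p' q' hp'] at hw'
    obtain ⟨⟨hq₁, _⟩, hq₂, _⟩ := (hI p q).1 hp
    obtain ⟨⟨hq₁', _⟩, hq₂', _⟩ := (hI p' q').1 hp'
    obtain ⟨e₁, e₂⟩ := hinj _ hq₁ _ hq₂ _ hq₁' _ hq₂' w hw hw'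
    exact Prod.ext e₁ e₂

lemma setOf_map_length_eq {A T : Type*} (f : A → T) (L : Language A) (n : ℕ) :
    {w : List T | w ∈ Language.map f L ∧ w.length = n}
      = List.map f '' {w : List A | w ∈ L ∧ w.length = n} := by
  ext w
  constructor
  · rintro ⟨⟨v, hv, rfl⟩, hn⟩
    exact ⟨v, ⟨hv, by simpa using hn⟩, rfl⟩
  · rintro ⟨v, ⟨hv, hn⟩, rfl⟩
    exact ⟨⟨v, hv, rfl⟩, by simpa using hn⟩

lemma IsProper.map {A T : Type*} {L : Language A} (hL : L.IsProper) (f : A → T) :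
    (Language.map f L).IsProper := fun n => by
  rw [setOf_map_length_eq]
  exact (hL n).image _

lemma letters_map {A T : Type*} (f : A → T) (L : Language A) :
    (Language.map f L).letters = f '' L.letters := by
  ext a
  constructor
  · rintro ⟨_, ⟨w, hw, rfl⟩, ha⟩
    obtain ⟨b, hb, rfl⟩ := List.mem_map.1 ha
    exact ⟨b, ⟨w, hw, hb⟩, rfl⟩
  · rintro ⟨b, ⟨w, hw, hb⟩, rfl⟩
    exact ⟨_, ⟨w, hw, rfl⟩, List.mem_map_of_mem hb⟩

lemma genFun_map {A T : Type*} {L : Language A} {f : A → T} (hf : Set.InjOn f L.letters) :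
    (Language.map f L).genFun = L.genFun := by
  ext n
  rw [coeff_genFun, coeff_genFun, wordCount, setOf_map_length_eq, Set.InjOn.ncard_image,
    wordCount]
  rintro v ⟨hv, _⟩ w ⟨hw, _⟩ h
  -- `f` is injective only on the letters of `L`, so words are compared letter by letter within that
  -- set.
  have key : ∀ v w : List A, (∀ a ∈ v, a ∈ L.letters) → (∀ a ∈ w, a ∈ L.letters) →
      v.map f = w.map f → v = w := by
    intro v
    induction v with
    | nil => intro w _ _ h; simpa [eq_comm] using h
    | cons a v ih =>
      rintro (_ | ⟨b, w⟩) hv hw h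
      · simp at h
      · simp only [List.map_cons, List.cons.injEq] at h
        rw [hf (hv a (by simp)) (hw b (by simp)) h.1,
          ih w (fun c hc => hv c (by simp [hc])) (fun c hc => hw c (by simp [hc])) h.2]
  exact key v w (fun a ha => ⟨v, hv, ha⟩) (fun a ha => ⟨w, hw, ha⟩) h

end Language

/-! ### Shuffles of two words. -/

lemma wordShuffle_nil_right {T : Type*} (w : List T) : wordShuffle w [] = {w} := by
  cases w <;> simp [wordShuffle]

lemma wordShuffle_nil_left {T : Type*} (w : List T) : wordShuffle [] w = {w} := by
  simp [wordShuffle]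

lemma wordShuffle_cons_cons {T : Type*} (a b : T) (v w : List T) :
    wordShuffle (a :: v) (b :: w) =
      (List.cons a) '' wordShuffle v (b :: w) ∪ (List.cons b) '' wordShuffle (a :: v) w := by
  rw [wordShuffle]

lemma wordShuffle_induction {T : Type*} {motive : List T → List T → Prop}
    (nil_left : ∀ w, motive [] w) (nil_right : ∀ w, motive w [])
    (cons : ∀ a v b w, motive v (b :: w) → motive (a :: v) w → motive (a :: v) (b :: w)) :
    ∀ v w, motive v w
  | [], w => nil_left w
  | a :: v, [] => nil_right (a :: v)
  | a :: v, b :: w => cons a v b w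
      (wordShuffle_induction nil_left nil_right cons v (b :: w))
      (wordShuffle_induction nil_left nil_right cons (a :: v) w)
  termination_by v w => v.length + w.length

lemma length_of_mem_wordShuffle {T : Type*} (v w : List T) :
    ∀ x ∈ wordShuffle v w, x.length = v.length + w.length := by
  induction v, w using wordShuffle_induction with
  | nil_left w => simp [wordShuffle_nil_left]
  | nil_right w => simp [wordShuffle_nil_right]
  | cons a v b w h₁ h₂ =>
    rw [wordShuffle_cons_cons]
    rintro _ (⟨x, hx, rfl⟩ | ⟨x, hx, rfl⟩)
    · simp [h₁ x hx]; omega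
    · simp [h₂ x hx]; omega

lemma finite_wordShuffle {T : Type*} (v w : List T) : (wordShuffle v w).Finite := by
  induction v, w using wordShuffle_induction with
  | nil_left w => simp [wordShuffle_nil_left]
  | nil_right w => simp [wordShuffle_nil_right]
  | cons a v b w h₁ h₂ =>
    rw [wordShuffle_cons_cons]
    exact (h₁.image _).union (h₂.image _)

/-- Unique decoding: when `P` separates the alphabets, a shuffle determines both of its factors. -/
lemma filter_of_mem_wordShuffle {T : Type*} (P : T → Prop) [DecidablePred P] (v w : List T)
    (hv : ∀ a ∈ v, P a) (hw : ∀ a ∈ w, ¬ P a) :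
    ∀ x ∈ wordShuffle v w, x.filter (fun a => P a) = v ∧ x.filter (fun a => ¬ P a) = w := by
  induction v, w using wordShuffle_induction with
  | nil_left w => simpa [wordShuffle_nil_left, List.filter_eq_nil_iff] using hw
  | nil_right w => simpa [wordShuffle_nil_right, List.filter_eq_nil_iff] using hv
  | cons a v b w h₁ h₂ =>
    rw [wordShuffle_cons_cons]
    have ha : P a := hv a (by simp)
    have hb : ¬ P b := hw b (by simp)
    rintro _ (⟨x, hx, rfl⟩ | ⟨x, hx, rfl⟩)
    · simpa [List.filter_cons, ha] using h₁ (fun c hc => hv c (by simp [hc])) hw x hx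
    · simpa [List.filter_cons, hb] using h₂ hv (fun c hc => hw c (by simp [hc])) x hx

/-- Distinct first letters make the union in the recursion disjoint, and the recursion becomes
Pascal's rule. -/
lemma ncard_wordShuffle {T : Type*} (v w : List T) (hvw : ∀ a ∈ v, ∀ b ∈ w, a ≠ b) :
    (wordShuffle v w).ncard = (v.length + w.length).choose v.length := by
  induction v, w using wordShuffle_induction with
  | nil_left w => simp [wordShuffle_nil_left]
  | nil_right w => simp [wordShuffle_nil_right]
  | cons a v b w h₁ h₂ =>
    have hab : a ≠ b := hvw a (by simp) b (by simp)
    rw [wordShuffle_cons_cons, Set.ncard_union_eq _ ((finite_wordShuffle _ _).image _)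
      ((finite_wordShuffle _ _).image _), Set.ncard_image_of_injective _ List.cons_injective,
      Set.ncard_image_of_injective _ List.cons_injective,
      h₁ fun c hc d hd => hvw c (by simp [hc]) d hd,
      h₂ fun c hc d hd => hvw c hc d (by simp [hd])]
    · simp only [List.length_cons]
      rw [show v.length + 1 + (w.length + 1) = (v.length + (w.length + 1)) + 1 by ring,
        Nat.choose_succ_succ, show v.length + 1 + w.length = v.length + (w.length + 1) by ring]
    · refine Set.disjoint_left.2 ?_
      rintro _ ⟨x, _, rfl⟩ ⟨y, _, h⟩
      simp only [List.cons.injEq] at h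
      exact hab h.1.symm

/-! ### Shuffles of languages and their exponential generating functions. -/

namespace Language

lemma wordCount_shuffle {T : Type*} {L₁ L₂ : Language T} (h₁ : L₁.IsProper) (h₂ : L₂.IsProper)
    (hd : Disjoint L₁.letters L₂.letters) :
    (L₁.shuffle L₂).IsProper ∧ ∀ n, (L₁.shuffle L₂).wordCount n = ∑ p ∈ Finset.HasAntidiagonal.antidiagonal n,
      (p.1 + p.2).choose p.1 * (L₁.wordCount p.1 * L₂.wordCount p.2) := by
  classical
  have hmem₁ : ∀ w ∈ L₁, ∀ a ∈ w, a ∈ L₁.letters := fun w hw a ha => ⟨w, hw, ha⟩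
  have hmem₂ : ∀ w ∈ L₂, ∀ a ∈ w, a ∉ L₁.letters := fun w hw a ha h =>
    Set.disjoint_left.1 hd h ⟨w, hw, ha⟩
  refine wordCount_of_combine wordShuffle (fun k m => (k + m).choose k) h₁ h₂ (fun w => Iff.rfl)
    (fun v _ w _ => length_of_mem_wordShuffle v w) (fun v _ w _ => finite_wordShuffle v w)
    (fun v hv w hw => ncard_wordShuffle v w ?_) ?_
  · rintro a ha b hb rfl
    exact hmem₂ w hw a hb (hmem₁ v hv a ha)
  · intro v hv w hw v' hv' w' hw' x hx hx'
    have h := filter_of_mem_wordShuffle (· ∈ L₁.letters) v w (hmem₁ v hv) (hmem₂ w hw) x hx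
    have h' := filter_of_mem_wordShuffle (· ∈ L₁.letters) v' w' (hmem₁ v' hv') (hmem₂ w' hw') x hx'
    exact ⟨h.1.symm.trans h'.1, h.2.symm.trans h'.2⟩

/-- A binomial convolution of counts is an ordinary convolution after division by factorials. -/
lemma borel_genFun_shuffle {T : Type*} {L₁ L₂ : Language T} (h₁ : L₁.IsProper) (h₂ : L₂.IsProper)
    (hd : Disjoint L₁.letters L₂.letters) :
    PowerSeries.borel (L₁.shuffle L₂).genFun =
      PowerSeries.borel L₁.genFun * PowerSeries.borel L₂.genFun := by
  ext n
  rw [PowerSeries.coeff_mul, PowerSeries.coeff_borel, coeff_genFun,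
    (wordCount_shuffle h₁ h₂ hd).2 n, Nat.cast_sum, Finset.sum_div]
  refine Finset.sum_congr rfl fun p hp => ?_
  rw [PowerSeries.coeff_borel, PowerSeries.coeff_borel, coeff_genFun, coeff_genFun,
    ← Finset.HasAntidiagonal.mem_antidiagonal.1 hp]
  push_cast
  rw [Nat.cast_add_choose]
  have := Nat.factorial_ne_zero p.1
  have := Nat.factorial_ne_zero p.2
  have := Nat.factorial_ne_zero (p.1 + p.2)
  field_simp

theorem IsDisjointShuffle.isProper_and_isDFinite {A B T : Type*} {L₁ : Language A}
    {L₂ : Language B} {L : Language T} (h : IsDisjointShuffle L₁ L₂ L)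
    (h₁ : L₁.IsProper ∧ L₁.genFun.IsDFinite) (h₂ : L₂.IsProper ∧ L₂.genFun.IsDFinite) :
    L.IsProper ∧ L.genFun.IsDFinite := by
  obtain ⟨f, g, hf, hg, hd, rfl⟩ := h
  rw [← letters_map, ← letters_map] at hd
  have p₁ := h₁.1.map f
  have p₂ := h₂.1.map g
  refine ⟨(wordCount_shuffle p₁ p₂ hd).1, PowerSeries.IsDFinite.of_borel ?_⟩
  rw [borel_genFun_shuffle p₁ p₂ hd, genFun_map hf, genFun_map hg]
  exact h₁.2.borel.mul h₂.2.borel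

end Language

/-! ### Leftmost derivations of words and their decomposition. -/

namespace ContextFreeGrammar

variable {T : Type*} {g : ContextFreeGrammar T}

/-- `WordDerivation rs x w`: the list of rules `rs` is that of a leftmost derivation of the word
`w` from the sentential form `x`. -/
inductive WordDerivation {T : Type*} {g : ContextFreeGrammar T} :
    List (ContextFreeRule T g.NT) → List (Symbol T g.NT) → List T → Prop
  | nil : WordDerivation [] [] []
  | terminal {rs : List (ContextFreeRule T g.NT)} {x : List (Symbol T g.NT)} {w : List T} (a : T)
      (h : WordDerivation rs x w) : WordDerivation rs (Symbol.terminal a :: x) (a :: w)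
  | nonterminal {rs : List (ContextFreeRule T g.NT)} {x : List (Symbol T g.NT)} {w : List T}
      {r : ContextFreeRule T g.NT} (hr : r ∈ g.rules) (h : WordDerivation rs (r.output ++ x) w) :
      WordDerivation (r :: rs) (Symbol.nonterminal r.input :: x) w

namespace WordDerivation

lemma nil_iff {rs : List (ContextFreeRule T g.NT)} {w : List T} :
    WordDerivation rs ([] : List (Symbol T g.NT)) w ↔ rs = [] ∧ w = [] := by
  constructor
  · rintro ⟨⟩
    exact ⟨rfl, rfl⟩
  · rintro ⟨rfl, rfl⟩
    exact .nil

lemma terminal_iff {rs : List (ContextFreeRule T g.NT)} {a : T} {x : List (Symbol T g.NT)}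
    {w : List T} : WordDerivation rs (Symbol.terminal a :: x) w ↔
      ∃ v, w = a :: v ∧ WordDerivation rs x v := by
  constructor
  · rintro (_ | ⟨_, h⟩ | _)
    exact ⟨_, rfl, h⟩
  · rintro ⟨v, rfl, h⟩
    exact .terminal a h

lemma nonterminal_iff {rs : List (ContextFreeRule T g.NT)} {A : g.NT} {x : List (Symbol T g.NT)}
    {w : List T} : WordDerivation rs (Symbol.nonterminal A :: x) w ↔
      ∃ r ∈ g.rules, r.input = A ∧ ∃ rs', rs = r :: rs' ∧ WordDerivation rs' (r.output ++ x) w := by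
  constructor
  · rintro (_ | _ | ⟨hr, h⟩)
    exact ⟨_, hr, rfl, _, rfl, h⟩
  · rintro ⟨r, hr, rfl, rs', rfl, h⟩
    exact .nonterminal hr h

lemma map_terminal_append_iff {rs : List (ContextFreeRule T g.NT)} {p : List T}
    {x : List (Symbol T g.NT)} {w : List T} :
    WordDerivation rs (p.map Symbol.terminal ++ x) w ↔ ∃ v, w = p ++ v ∧ WordDerivation rs x v := by
  induction p generalizing w with
  | nil => simp
  | cons a p ih =>
    rw [List.map_cons, List.cons_append, terminal_iff]
    simp only [ih]
    constructor
    · rintro ⟨_, rfl, v, rfl, h⟩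
      exact ⟨v, rfl, h⟩
    · rintro ⟨v, rfl, h⟩
      exact ⟨_, rfl, v, rfl, h⟩

lemma map_terminal (w : List T) :
    WordDerivation [] (w.map Symbol.terminal : List (Symbol T g.NT)) w := by
  induction w with
  | nil => exact .nil
  | cons a w ih => exact .terminal a ih

lemma of_leftmostDerivation {rs : List (ContextFreeRule T g.NT)} {x y : List (Symbol T g.NT)}
    {w : List T} (h : g.LeftmostDerivation rs x y) (hy : y = w.map Symbol.terminal) :
    WordDerivation rs x w := by
  induction h with
  | nil x => exact hy ▸ map_terminal w
  | cons hr hxy _ ih =>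
    obtain ⟨p, q, rfl, rfl⟩ := hxy
    have := ih hy
    rw [List.append_assoc, map_terminal_append_iff] at this
    obtain ⟨v, rfl, hv⟩ := this
    rw [List.append_assoc, map_terminal_append_iff]
    exact ⟨v, rfl, .nonterminal hr hv⟩

lemma leftmostDerivation {rs : List (ContextFreeRule T g.NT)} {x : List (Symbol T g.NT)}
    {w : List T} (h : WordDerivation rs x w) :
    g.LeftmostDerivation rs x (w.map Symbol.terminal) := by
  induction h with
  | nil => exact .nil _
  | @terminal rs x w a h ih =>
    -- The target is generalized so that the inner induction can add `a` to the terminal prefix of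
    -- every step.
    clear h
    rw [List.map_cons]
    generalize (w.map Symbol.terminal : List (Symbol T g.NT)) = y at ih
    induction ih with
    | nil => exact .nil _
    | cons hr hxy _ ih =>
      obtain ⟨p, q, rfl, rfl⟩ := hxy
      exact .cons hr ⟨a :: p, q, by simp, by simp⟩ ih
  | @nonterminal rs x w r hr _ ih => exact .cons hr ⟨[], x, by simp, by simp⟩ ih

lemma append {rs rs' : List (ContextFreeRule T g.NT)} {x y : List (Symbol T g.NT)} {v w : List T}
    (h : WordDerivation rs x v) (h' : WordDerivation rs' y w) :
    WordDerivation (rs ++ rs') (x ++ y) (v ++ w) := by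
  induction h with
  | nil => exact h'
  | terminal a _ ih => exact .terminal a ih
  | nonterminal hr _ ih => exact .nonterminal hr ((List.append_assoc _ _ _) ▸ ih)

/-- A leftmost derivation finishes `x` before it touches `y`, so its rules split into two
consecutive blocks. -/
lemma exists_of_append {rs : List (ContextFreeRule T g.NT)} {x y : List (Symbol T g.NT)}
    {w : List T} (h : WordDerivation rs (x ++ y) w) : ∃ rs₁ rs₂ w₁ w₂, rs = rs₁ ++ rs₂ ∧
      w = w₁ ++ w₂ ∧ WordDerivation rs₁ x w₁ ∧ WordDerivation rs₂ y w₂ := by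
  generalize hz : x ++ y = z at h
  induction h generalizing x with
  | nil =>
    obtain ⟨rfl, rfl⟩ := List.append_eq_nil_iff.1 hz
    exact ⟨[], [], [], [], rfl, rfl, .nil, .nil⟩
  | @terminal rs z w a h ih =>
    rcases x with _ | ⟨s, x⟩
    · exact ⟨[], rs, [], a :: w, rfl, rfl, .nil, by
        rw [List.nil_append] at hz; exact hz ▸ .terminal a h⟩
    · rw [List.cons_append, List.cons.injEq] at hz
      obtain ⟨rs₁, rs₂, w₁, w₂, rfl, rfl, h₁, h₂⟩ := ih hz.2
      exact ⟨rs₁, rs₂, a :: w₁, w₂, rfl, rfl, hz.1 ▸ .terminal a h₁, h₂⟩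
  | @nonterminal rs z w r hr h ih =>
    rcases x with _ | ⟨s, x⟩
    · exact ⟨[], r :: rs, [], w, rfl, rfl, .nil, by
        rw [List.nil_append] at hz; exact hz ▸ .nonterminal hr h⟩
    · rw [List.cons_append, List.cons.injEq] at hz
      obtain ⟨rs₁, rs₂, w₁, w₂, rfl, rfl, h₁, h₂⟩ := ih (x := r.output ++ x) (by
        rw [List.append_assoc, hz.2])
      exact ⟨r :: rs₁, rs₂, w₁, w₂, rfl, rfl, hz.1 ▸ .nonterminal hr h₁, h₂⟩

/-- The rules dictate every step from `x`, so complete derivations form a prefix code. This locates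
the cut in a concatenated derivation. -/
lemma eq_of_prefix {rs t : List (ContextFreeRule T g.NT)} {x : List (Symbol T g.NT)}
    {v w : List T} (h : WordDerivation rs x v) (h' : WordDerivation (rs ++ t) x w) :
    t = [] ∧ v = w := by
  induction h generalizing w with
  | nil =>
    rw [nil_iff] at h'
    simpa [eq_comm] using h'
  | terminal a _ ih =>
    obtain ⟨w, rfl, hw⟩ := terminal_iff.1 h'
    obtain ⟨rfl, rfl⟩ := ih hw
    exact ⟨rfl, rfl⟩
  | nonterminal hr _ ih =>
    obtain ⟨r, _, _, rs', he, hw⟩ := nonterminal_iff.1 h'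
    rw [List.cons_append, List.cons.injEq] at he
    obtain ⟨rfl, rfl⟩ := he
    exact ih hw

lemma mem_letters {rs : List (ContextFreeRule T g.NT)} {x : List (Symbol T g.NT)} {w : List T}
    (h : WordDerivation rs x w) {a : T} (ha : a ∈ w) :
    Symbol.terminal a ∈ x ∨ ∃ r ∈ g.rules, Symbol.terminal a ∈ r.output := by
  induction h with
  | nil => simp at ha
  | terminal b _ ih =>
    rcases List.mem_cons.1 ha with rfl | ha
    · simp
    · rcases ih ha with h | h
      · simp [h]
      · exact .inr h
  | nonterminal hr _ ih =>
    rcases ih ha with h | h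
    · rcases List.mem_append.1 h with h | h
      · exact .inr ⟨_, hr, h⟩
      · simp [h]
    · exact .inr h

end WordDerivation

/-- The words that can be derived from a sentential form. -/
def wordsOf (x : List (Symbol T g.NT)) : Language T :=
  {w : List T | ∃ rs, WordDerivation rs x w}

/-- Every word has at most one leftmost derivation from the sentential form `x`. -/
def IsUniquelyDeriving (x : List (Symbol T g.NT)) : Prop :=
  ∀ w rs rs', WordDerivation rs x w → WordDerivation rs' x w → rs = rs'

/-- `T` may be infinite, but only the finitely many terminals in `x` and in the rules can occur. -/
lemma isProper_wordsOf (x : List (Symbol T g.NT)) : (wordsOf x).IsProper := by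
  intro n
  let S : Set T := {a | Symbol.terminal a ∈ x ∨ ∃ r ∈ g.rules, Symbol.terminal a ∈ r.output}
  have hinj : Function.Injective (Symbol.terminal : T → Symbol T g.NT) := fun _ _ h => by
    simpa using h
  have hlist : ∀ y : List (Symbol T g.NT), {a : T | Symbol.terminal a ∈ y}.Finite := fun y =>
    (List.finite_toSet y).preimage hinj.injOn
  have hS : S.Finite := by
    refine ((hlist x).union (g.rules.finite_toSet.biUnion fun r _ => hlist r.output)).subset ?_
    rintro a (h | ⟨r, hr, h⟩)
    · exact .inl h
    · exact .inr (Set.mem_biUnion hr h)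
  have : Finite S := hS
  refine ((List.finite_length_eq S n).image (List.map Subtype.val)).subset ?_
  rintro w ⟨⟨rs, h⟩, hn⟩
  refine ⟨w.attach.map fun a => ⟨a.1, h.mem_letters a.2⟩, by simpa using hn, ?_⟩
  simp [List.map_map, Function.comp_def]

lemma wordsOf_nil : wordsOf ([] : List (Symbol T g.NT)) = 1 := by
  ext w
  change (∃ rs, _) ↔ w ∈ (1 : Language T)
  simp [WordDerivation.nil_iff, Language.mem_one]

lemma wordsOf_terminal (a : T) : wordsOf ([.terminal a] : List (Symbol T g.NT)) = {[a]} := by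
  ext w
  change (∃ rs, _) ↔ w = [a]
  simp [WordDerivation.nil_iff, WordDerivation.terminal_iff]

/-- The singleton matches the argument `op` of `wordCount_of_combine`. -/
lemma mem_wordsOf_append {x y : List (Symbol T g.NT)} {w : List T} :
    w ∈ wordsOf (x ++ y) ↔ ∃ w₁ ∈ wordsOf x, ∃ w₂ ∈ wordsOf y, w ∈ ({w₁ ++ w₂} : Set (List T)) := by
  constructor
  · rintro ⟨rs, h⟩
    obtain ⟨rs₁, rs₂, w₁, w₂, rfl, rfl, h₁, h₂⟩ := h.exists_of_append
    exact ⟨w₁, ⟨_, h₁⟩, w₂, ⟨_, h₂⟩, rfl⟩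
  · rintro ⟨w₁, ⟨_, h₁⟩, w₂, ⟨_, h₂⟩, rfl⟩
    exact ⟨_, h₁.append h₂⟩

lemma nonempty_wordsOf_append {x y : List (Symbol T g.NT)} :
    (∃ w, w ∈ wordsOf (x ++ y)) ↔ (∃ w, w ∈ wordsOf x) ∧ ∃ w, w ∈ wordsOf y := by
  simp only [mem_wordsOf_append]
  constructor
  · rintro ⟨_, v, hv, w, hw, _⟩
    exact ⟨⟨v, hv⟩, w, hw⟩
  · rintro ⟨⟨v, hv⟩, w, hw⟩
    exact ⟨_, v, hv, w, hw, rfl⟩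

namespace IsUniquelyDeriving

lemma left {x y : List (Symbol T g.NT)} (h : IsUniquelyDeriving (x ++ y))
    (hy : ∃ w, w ∈ wordsOf y) : IsUniquelyDeriving x := by
  obtain ⟨v, t, ht⟩ := hy
  intro w rs rs' h₁ h₂
  exact List.append_cancel_right (h _ _ _ (h₁.append ht) (h₂.append ht))

lemma right {x y : List (Symbol T g.NT)} (h : IsUniquelyDeriving (x ++ y))
    (hx : ∃ w, w ∈ wordsOf x) : IsUniquelyDeriving y := by
  obtain ⟨v, t, ht⟩ := hx
  intro w rs rs' h₁ h₂
  exact List.append_cancel_left (h _ _ _ (ht.append h₁) (ht.append h₂))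

lemma output {r : ContextFreeRule T g.NT} (hr : r ∈ g.rules)
    (h : IsUniquelyDeriving [Symbol.nonterminal r.input]) : IsUniquelyDeriving r.output := by
  intro w rs rs' h₁ h₂
  have := h w (r :: rs) (r :: rs') (.nonterminal hr (by simpa using h₁))
    (.nonterminal hr (by simpa using h₂))
  simpa using this

/-- Two factorizations of a word give two concatenated derivations, equal by uniqueness. One first
block is then a prefix of the other, and `eq_of_prefix` identifies the factors. -/
lemma genFun_append {x y : List (Symbol T g.NT)} (h : IsUniquelyDeriving (x ++ y)) :
    (wordsOf (x ++ y)).genFun = (wordsOf x).genFun * (wordsOf y).genFun := by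
  ext n
  rw [PowerSeries.coeff_mul, Language.coeff_genFun, (Language.wordCount_of_combine
    (fun v w => {v ++ w}) (fun _ _ => 1) (isProper_wordsOf x) (isProper_wordsOf y)
    (fun w => mem_wordsOf_append) ?_ ?_ ?_ ?_).2 n]
  · simp [Language.coeff_genFun]
  · rintro v _ w _ _ rfl
    simp
  · intros
    exact Set.finite_singleton _
  · intros
    exact Set.ncard_singleton _
  · rintro v ⟨rs₁, h₁⟩ w ⟨rs₂, h₂⟩ v' ⟨rs₁', h₁'⟩ w' ⟨rs₂', h₂'⟩ _ rfl (he : v ++ w = v' ++ w')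
    have key := h _ _ _ (h₁.append h₂) (he ▸ h₁'.append h₂')
    have hv : v = v' := by
      rcases List.append_eq_append_iff.1 key with ⟨t, rfl, _⟩ | ⟨t, rfl, _⟩
      · exact (h₁.eq_of_prefix h₁').2
      · exact (h₁'.eq_of_prefix h₁).2.symm
    subst hv
    exact ⟨rfl, List.append_cancel_left he⟩

open Classical in
-- Classify words by the first rule; uniqueness makes the classes disjoint. Rules whose output
-- derives no word contribute nothing and are dropped.
lemma genFun_nonterminal {A : g.NT} (h : IsUniquelyDeriving [Symbol.nonterminal A]) :
    (wordsOf [Symbol.nonterminal A]).genFun =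
      ∑ r ∈ g.rules with r.input = A ∧ ∃ w, w ∈ wordsOf r.output, (wordsOf r.output).genFun := by
  ext n
  rw [map_sum, Language.coeff_genFun]
  simp only [Language.coeff_genFun]
  rw [← Nat.cast_sum, Language.wordCount]
  congr 1
  have hset : {w | w ∈ wordsOf [Symbol.nonterminal A] ∧ w.length = n} =
      ↑((g.rules.filter fun r => r.input = A ∧ ∃ w, w ∈ wordsOf r.output).biUnion
        fun r => (isProper_wordsOf r.output n).toFinset) := by
    ext w
    simp only [Set.mem_ofPred_eq, Finset.coe_biUnion, Finset.mem_coe, Set.mem_iUnion,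
      Finset.mem_filter, Set.Finite.coe_toFinset, exists_prop]
    constructor
    · rintro ⟨⟨rs, hw⟩, hn⟩
      obtain ⟨r, hr, hA, rs', rfl, hv⟩ := WordDerivation.nonterminal_iff.1 hw
      rw [List.append_nil] at hv
      exact ⟨r, ⟨hr, hA, w, _, hv⟩, ⟨_, hv⟩, hn⟩
    · rintro ⟨r, ⟨hr, rfl, _⟩, ⟨rs, hw⟩, hn⟩
      exact ⟨⟨_, .nonterminal hr (by rwa [List.append_nil])⟩, hn⟩
  rw [hset, Set.ncard_coe_finset, Finset.card_biUnion]
  · refine Finset.sum_congr rfl fun r _ => ?_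
    rw [Language.wordCount, Set.ncard_eq_toFinset_card _ (isProper_wordsOf r.output n)]
  · intro r hr r' hr' hne
    refine Finset.disjoint_left.2 fun w hw hw' => hne ?_
    obtain ⟨hg, he, _⟩ := Finset.mem_filter.1 hr
    obtain ⟨hg', he', _⟩ := Finset.mem_filter.1 hr'
    obtain ⟨⟨rs, hv⟩, _⟩ := (Set.Finite.mem_toFinset _).1 hw
    obtain ⟨⟨rs', hv'⟩, _⟩ := (Set.Finite.mem_toFinset _).1 hw'
    have := h w (r :: rs) (r' :: rs') (he ▸ .nonterminal hg (by rwa [List.append_nil]))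
      (he' ▸ .nonterminal hg' (by rwa [List.append_nil]))
    exact (List.cons.inj this).1

end IsUniquelyDeriving

end ContextFreeGrammar

/-! ### The polynomial system of a grammar. -/

namespace ContextFreeGrammar

variable {T : Type*} (g : ContextFreeGrammar T)

/-- The nonterminals from which some word can be derived, and every word in at most one way. -/
abbrev UnambiguousNT : Type :=
  {A : g.NT // IsUniquelyDeriving [Symbol.nonterminal A] ∧ ∃ w, w ∈ wordsOf [Symbol.nonterminal A]}

/-- `g.NT` may be infinite, but a nonterminal that derives a word is the input of one of finitely
many rules. -/
instance finite_unambiguousNT : Finite g.UnambiguousNT := by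
  have hfin : {A : g.NT | ∃ r ∈ g.rules, r.input = A}.Finite :=
    g.rules.finite_toSet.image ContextFreeRule.input
  refine (Set.Finite.subset (t := {A | IsUniquelyDeriving [Symbol.nonterminal A] ∧
    ∃ w, w ∈ wordsOf [Symbol.nonterminal A]}) hfin ?_).to_subtype
  rintro A ⟨_, w, rs, hw⟩
  obtain ⟨r, hr, hA, _⟩ := WordDerivation.nonterminal_iff.1 hw
  exact ⟨r, hr, hA⟩

noncomputable instance fintype_unambiguousNT : Fintype g.UnambiguousNT := Fintype.ofFinite _

open Classical in
noncomputable instance decidableEq_unambiguousNT : DecidableEq g.UnambiguousNT := inferInstance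

/-- The generating functions of the words derived from the nonterminals. -/
noncomputable def ntGenFun (A : g.UnambiguousNT) : PowerSeries ℚ :=
  (wordsOf [Symbol.nonterminal A.1]).genFun

open Classical in
/-- The weight of a symbol: `z` for a terminal, an unknown for a nonterminal. -/
noncomputable def symbolWeight : Symbol T g.NT → MvPolynomial g.UnambiguousNT ℚ[X]
  | .terminal _ => MvPolynomial.C Polynomial.X
  -- The default `0` does not enter `ntEquation`: symbols of the outputs kept there inherit both
  -- conditions.
  | .nonterminal A => if h : IsUniquelyDeriving [Symbol.nonterminal A] ∧
      ∃ w, w ∈ wordsOf [Symbol.nonterminal A] then MvPolynomial.X ⟨A, h⟩ else 0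

/-- The weight of a sentential form: the product of the weights of its symbols. -/
noncomputable def formWeight (x : List (Symbol T g.NT)) : MvPolynomial g.UnambiguousNT ℚ[X] :=
  (x.map g.symbolWeight).prod

open Classical in
/-- The polynomial equation that the rules for a nonterminal impose on the generating functions. -/
noncomputable def ntEquation (A : g.UnambiguousNT) : MvPolynomial g.UnambiguousNT ℚ[X] :=
  MvPolynomial.X A - ∑ r ∈ g.rules with r.input = A.1 ∧ ∃ w, w ∈ wordsOf r.output,
    g.formWeight r.output

variable {g}

lemma formWeight_cons (s : Symbol T g.NT) (x : List (Symbol T g.NT)) :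
    g.formWeight (s :: x) = g.symbolWeight s * g.formWeight x := by
  simp [formWeight]

lemma genFun_wordsOf_nil : (wordsOf ([] : List (Symbol T g.NT))).genFun = 1 := by
  ext n
  rw [Language.coeff_genFun, wordsOf_nil, PowerSeries.coeff_one, Language.wordCount]
  have : {w : List T | w ∈ (1 : Language T) ∧ w.length = n} = if n = 0 then {[]} else ∅ := by
    ext w
    rw [Set.mem_ofPred_eq, Language.mem_one]
    split_ifs with h
    · subst h; simp
    · simp only [Set.mem_empty_iff_false, iff_false, not_and]
      rintro rfl h'
      exact h h'.symm
  rw [this]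
  split_ifs <;> simp

lemma genFun_wordsOf_terminal (a : T) :
    (wordsOf ([.terminal a] : List (Symbol T g.NT))).genFun = PowerSeries.X := by
  ext n
  rw [Language.coeff_genFun, wordsOf_terminal, PowerSeries.coeff_X, Language.wordCount]
  have : {w : List T | w ∈ ({[a]} : Language T) ∧ w.length = n} = if n = 1 then {[a]} else ∅ := by
    ext w
    change w = [a] ∧ w.length = n ↔ _
    split_ifs with h
    · subst h
      constructor
      · exact fun h => h.1
      · rintro rfl
        exact ⟨rfl, rfl⟩
    · simp only [Set.mem_empty_iff_false, iff_false, not_and]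
      rintro rfl h'
      exact h h'.symm
  rw [this]
  split_ifs <;> simp

lemma aeval_symbolWeight {s : Symbol T g.NT} (h : IsUniquelyDeriving [s])
    (hs : ∃ w, w ∈ wordsOf [s]) :
    MvPolynomial.aeval g.ntGenFun (g.symbolWeight s) = (wordsOf [s]).genFun := by
  rcases s with a | A
  · rw [genFun_wordsOf_terminal, symbolWeight, MvPolynomial.aeval_C,
      PowerSeries.algebraMap_apply']
    simp
  · rw [symbolWeight, dif_pos ⟨h, hs⟩, MvPolynomial.aeval_X, ntGenFun]

lemma aeval_formWeight {x : List (Symbol T g.NT)} (h : IsUniquelyDeriving x)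
    (hx : ∃ w, w ∈ wordsOf x) :
    MvPolynomial.aeval g.ntGenFun (g.formWeight x) = (wordsOf x).genFun := by
  induction x with
  | nil => rw [genFun_wordsOf_nil]; simp [formWeight]
  | cons s x ih =>
    rw [← List.singleton_append] at h hx
    obtain ⟨hs, hx⟩ := nonempty_wordsOf_append.1 hx
    rw [formWeight_cons, map_mul, aeval_symbolWeight (h.left hx) hs, ih (h.right hs) hx,
      ← h.genFun_append, List.singleton_append]

lemma aeval_ntEquation (A : g.UnambiguousNT) :
    MvPolynomial.aeval g.ntGenFun (g.ntEquation A) = 0 := by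
  classical
  rw [ntEquation, map_sub, MvPolynomial.aeval_X, ntGenFun, A.2.1.genFun_nonterminal, map_sum,
    sub_eq_zero]
  refine Finset.sum_congr rfl fun r hr => ?_
  obtain ⟨hr, hA, hw⟩ := Finset.mem_filter.1 hr
  exact (aeval_formWeight (IsUniquelyDeriving.output hr (hA ▸ A.2.1)) hw).symm

lemma nil_mem_wordsOf_symbol {s : Symbol T g.NT} (h : PowerSeries.constantCoeff
    (MvPolynomial.aeval g.ntGenFun (g.symbolWeight s)) ≠ 0) : [] ∈ wordsOf [s] := by
  rcases s with a | A
  · rw [symbolWeight, MvPolynomial.aeval_C, PowerSeries.algebraMap_apply'] at h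
    simp at h
  · rw [symbolWeight] at h
    split_ifs at h with hA
    · rw [MvPolynomial.aeval_X, ntGenFun, ← PowerSeries.coeff_zero_eq_constantCoeff_apply,
        Language.coeff_genFun, Nat.cast_ne_zero] at h
      obtain ⟨w, hw, hn⟩ := Set.nonempty_of_ncard_ne_zero h
      rwa [List.length_eq_zero_iff.1 hn] at hw
    · simp at h

lemma nil_mem_wordsOf_append {x y : List (Symbol T g.NT)} (hx : [] ∈ wordsOf x)
    (hy : [] ∈ wordsOf y) : [] ∈ wordsOf (x ++ y) :=
  mem_wordsOf_append.2 ⟨_, hx, _, hy, rfl⟩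

lemma nil_mem_wordsOf {x : List (Symbol T g.NT)} (h : PowerSeries.constantCoeff
    (MvPolynomial.aeval g.ntGenFun (g.formWeight x)) ≠ 0) : [] ∈ wordsOf x := by
  induction x with
  | nil => exact ⟨[], .nil⟩
  | cons s x ih =>
    rw [formWeight_cons, map_mul, map_mul, mul_ne_zero_iff] at h
    exact nil_mem_wordsOf_append (nil_mem_wordsOf_symbol h.1) (ih h.2)

/-- By Leibniz the derivative sums over the occurrences of `B` in `x` the product of the remaining
weights; a nonzero constant term requires all remaining symbols to be erasable. -/
lemma exists_eq_append_of_pderiv_ne_zero {B : g.UnambiguousNT} {x : List (Symbol T g.NT)}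
    (h : PowerSeries.constantCoeff (MvPolynomial.aeval g.ntGenFun
      (MvPolynomial.pderiv B (g.formWeight x))) ≠ 0) :
    ∃ y z, x = y ++ Symbol.nonterminal B.1 :: z ∧ [] ∈ wordsOf y ∧ [] ∈ wordsOf z := by
  induction x with
  | nil => simp [formWeight] at h
  | cons s x ih =>
    rw [formWeight_cons, Derivation.leibniz, smul_eq_mul, smul_eq_mul, map_add, map_mul, map_mul,
      map_add, map_mul, map_mul] at h
    by_cases h₁ : PowerSeries.constantCoeff (MvPolynomial.aeval g.ntGenFun (g.symbolWeight s)) *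
        PowerSeries.constantCoeff (MvPolynomial.aeval g.ntGenFun
          (MvPolynomial.pderiv B (g.formWeight x))) = 0
    · rw [h₁, zero_add, mul_ne_zero_iff] at h
      refine ⟨[], x, ?_, ⟨[], .nil⟩, nil_mem_wordsOf h.1⟩
      rcases s with a | A
      · simp [symbolWeight] at h
      · rw [symbolWeight] at h
        split_ifs at h with hA
        · by_cases hAB : B = ⟨A, hA⟩
          · subst hAB; rfl
          · rw [MvPolynomial.pderiv_X_of_ne (Ne.symm hAB)] at h
            simp at h
        · simp at h
    · rw [← ne_eq, mul_ne_zero_iff] at h₁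
      obtain ⟨y, z, rfl, hy, hz⟩ := ih h₁.2
      exact ⟨s :: y, z, rfl, nil_mem_wordsOf_append (nil_mem_wordsOf_symbol h₁.1) hy, hz⟩

/-! ### Nonvanishing of the Jacobian. -/

/-- `A` derives `B` in at least one step, up to forms that derive the empty word: derivations from
`B` extend to longer derivations of the same words from `A`. -/
def Extends (A B : g.UnambiguousNT) : Prop :=
  ∃ rs₁ rs₂ : List (ContextFreeRule T g.NT), rs₁ ≠ [] ∧ ∀ rs w,
    WordDerivation rs [Symbol.nonterminal B.1] w →
      WordDerivation (rs₁ ++ rs ++ rs₂) [Symbol.nonterminal A.1] w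

lemma Extends.trans {A B C : g.UnambiguousNT} (h : Extends A B) (h' : Extends B C) :
    Extends A C := by
  obtain ⟨rs₁, rs₂, hne, h⟩ := h
  obtain ⟨rs₁', rs₂', _, h'⟩ := h'
  refine ⟨rs₁ ++ rs₁', rs₂' ++ rs₂, by simp [hne], fun rs w hw => ?_⟩
  simpa using h _ _ (h' _ _ hw)

/-- Otherwise a derivation from `A` and its strictly longer extension would yield the same word. -/
lemma Extends.irrefl (A : g.UnambiguousNT) : ¬ Extends A A := by
  rintro ⟨rs₁, rs₂, hne, h⟩
  obtain ⟨w, rs, hw⟩ := A.2.2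
  have := congrArg List.length (A.2.1 w _ _ hw (h rs w hw))
  simp only [List.length_append] at this
  exact hne (List.length_eq_zero_iff.1 (by omega))

lemma extends_of_pderiv_ne_zero {A B : g.UnambiguousNT} {r : ContextFreeRule T g.NT}
    (hr : r ∈ g.rules) (hA : r.input = A.1) (h : PowerSeries.constantCoeff
      (MvPolynomial.aeval g.ntGenFun (MvPolynomial.pderiv B (g.formWeight r.output))) ≠ 0) :
    Extends A B := by
  obtain ⟨y, z, hyz, ⟨rs₁, hy⟩, rs₂, hz⟩ := exists_eq_append_of_pderiv_ne_zero h
  refine ⟨r :: rs₁, rs₂, by simp, fun rs w hw => ?_⟩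
  have hd := hy.append (hw.append hz)
  rw [List.singleton_append, ← hyz, List.nil_append, List.append_nil] at hd
  rw [← hA, List.cons_append, List.cons_append]
  exact .nonterminal hr (by simpa using hd)

/-- It suffices to look at constant terms: they form the identity minus a matrix supported on the
strict order `Extends`. -/
lemma det_pderiv_ntEquation_ne_zero : (Matrix.of fun A B : g.UnambiguousNT =>
    MvPolynomial.aeval g.ntGenFun (MvPolynomial.pderiv B (g.ntEquation A))).det ≠ 0 := by
  classical
  set M := Matrix.of fun A B : g.UnambiguousNT =>
    MvPolynomial.aeval g.ntGenFun (MvPolynomial.pderiv B (g.ntEquation A)) with hM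
  intro hdet
  have h0 : (M.map (PowerSeries.constantCoeff (R := ℚ))).det = 0 := by
    rw [← RingHom.mapMatrix_apply, ← RingHom.map_det, hdet, map_zero]
  obtain ⟨v, hv, hMv⟩ := Matrix.exists_mulVec_eq_zero_iff.2 h0
  have : IsTrans g.UnambiguousNT (fun A B => Extends B A) := ⟨fun _ _ _ h h' => h'.trans h⟩
  have : Std.Irrefl (fun A B : g.UnambiguousNT => Extends B A) := ⟨Extends.irrefl⟩
  -- Choose `A` in the support of the kernel vector `v` so that no `B` with `Extends A B` lies in
  -- the support; row `A` then reads `v A = 0`.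
  obtain ⟨A, hvA, hmax⟩ := (Finite.wellFounded_of_trans_of_irrefl
    (fun A B : g.UnambiguousNT => Extends B A)).has_min {A | v A ≠ 0} (Function.ne_iff.1 hv)
  refine hvA ?_
  have hA := congrFun hMv A
  simp only [Matrix.mulVec, dotProduct, Matrix.map_apply, hM, Matrix.of_apply, ntEquation,
    map_sub, map_sum, sub_mul, Finset.sum_sub_distrib, Pi.zero_apply] at hA
  rw [Finset.sum_eq_single A, sub_eq_zero] at hA
  · rw [MvPolynomial.pderiv_X_self, map_one, map_one, one_mul] at hA
    rw [hA]
    refine Finset.sum_eq_zero fun B _ => ?_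
    by_cases hB : v B = 0
    · rw [hB, mul_zero]
    · rw [Finset.sum_eq_zero, zero_mul]
      intro r hr
      obtain ⟨hr, hrA, _⟩ := Finset.mem_filter.1 hr
      by_contra hne
      exact hmax B hB (extends_of_pderiv_ne_zero hr hrA hne)
  · intro B _ hBA
    rw [MvPolynomial.pderiv_X_of_ne hBA.symm]
    simp
  · simp

/-- The generating function of a nonterminal with unique derivations is algebraic. -/
theorem isAlgebraic_ntGenFun (A : g.UnambiguousNT) : IsAlgebraic ℚ[X] (g.ntGenFun A) :=
  isAlgebraic_of_det_pderiv_ne_zero g.ntEquation g.ntGenFun aeval_ntEquation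
    det_pderiv_ntEquation_ne_zero A

lemma wordDerivation_iff {rs : List (ContextFreeRule T g.NT)} {x : List (Symbol T g.NT)}
    {w : List T} : WordDerivation rs x w ↔ g.LeftmostDerivation rs x (w.map Symbol.terminal) :=
  ⟨WordDerivation.leftmostDerivation, fun h => .of_leftmostDerivation h rfl⟩

lemma LeftmostDerivation.derives {rs : List (ContextFreeRule T g.NT)} {x y : List (Symbol T g.NT)}
    (h : g.LeftmostDerivation rs x y) : g.Derives x y := by
  induction h with
  | nil x => exact Derives.refl x
  | cons hr hxy _ ih =>
    obtain ⟨p, q, rfl, rfl⟩ := hxy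
    exact Produces.trans_derives ⟨_, hr, ContextFreeRule.rewrites_of_exists_parts _ _ _⟩ ih

theorem IsUnambiguous.isProper_and_isDFinite (hg : g.IsUnambiguous) :
    g.language.IsProper ∧ g.language.genFun.IsDFinite := by
  -- Unambiguity itself provides a leftmost derivation of each word, so arbitrary derivations need
  -- not be reordered.
  have hlang : g.language = wordsOf [Symbol.nonterminal g.initial] := by
    ext w
    constructor
    · intro hw
      obtain ⟨rs, h, _⟩ := hg w hw
      exact ⟨rs, wordDerivation_iff.2 h⟩
    · rintro ⟨rs, h⟩
      exact h.leftmostDerivation.derives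
  have huniq : IsUniquelyDeriving [Symbol.nonterminal g.initial] := fun w rs rs' h h' =>
    (hg w h.leftmostDerivation.derives).unique h.leftmostDerivation h'.leftmostDerivation
  rw [hlang]
  refine ⟨isProper_wordsOf _, PowerSeries.isDFinite_of_isAlgebraic ?_⟩
  by_cases hne : ∃ w, w ∈ wordsOf [Symbol.nonterminal g.initial]
  · exact isAlgebraic_ntGenFun ⟨g.initial, huniq, hne⟩
  · have : (wordsOf [Symbol.nonterminal g.initial]).genFun = 0 := by
      ext n
      push Not at hne
      simp [Language.coeff_genFun, Language.wordCount, hne]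
    rw [this]
    exact isAlgebraic_zero

end ContextFreeGrammar

/-! ### Induction on the level of the shuffle closure. -/

theorem mainTheorem3 {T : Type u} (L : Language T)
    (hL : L ∈ LanguageClass.shuffleClosure unambiguousContextFree T) :
    L.IsProper ∧ L.genFun.IsDFinite := by
  obtain ⟨n, hn⟩ := Set.mem_iUnion.1 hL
  clear hL
  have hbase : ∀ (B : Type u) (L : Language B), L ∈ unambiguousContextFree B →
      L.IsProper ∧ L.genFun.IsDFinite := by
    rintro B _ ⟨g, rfl, hg⟩
    exact hg.isProper_and_isDFinite
  induction n generalizing T with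
  | zero => exact hbase T L hn
  | succ n ih =>
    obtain ⟨A, B, L₁, L₂, h₁, h₂, h⟩ := hn
    exact h.isProper_and_isDFinite (ih L₁ h₁) (hbase B L₂ h₂)
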